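/- **Setting.** Let $\omega\in C^{1,\gamma_0}([0,1])$ for some $\gamma_0\in(0,1)$, put $\Omega(p)=\int_0^p\omega(t)\,dt$ and $$R_c=\inf_{s}\Big(\tfrac12 s^2-\Omega(1)+\int_0^1\frac{dp}{\sqrt{s^2-2\Omega(p)}}\Big),$$ the infimum being over all $s>0$ with $s^2>\max_{[0,1]}2\Omega$ (this is the least Bernoulli constant of a laminar flow). For $\eta:\mathbb R\to(0,\infty)$ let $D_\eta=\{(x,y):0<y<\eta(x)\}$. A *Stokes wave* with vorticity function $\omega$ and Bernoulli constant $r$ is a pair $(\psi,\eta)\in C^{2,\gamma}(\overline{D_\eta})\times C^{2,\gamma}(\mathbb R)$, for some $\gamma\in(0,1)$, with $\eta>0$, such that $$\Delta\psi+\omega(\psi)=0\ \text{ in } D_\eta,\qquad \tfrac12|\nabla\psi|^2+y=r\ \text{ and }\ \psi=1\ \text{ on } y=\eta(x),\qquad \psi=0\ \text{ on } y=0,$$ $$\psi_y>0\ \text{ on } \overline{D_\eta},$$ and such that $\psi$ and $\eta$ are periodic in $x$ with a common period $\Lambda>0$, are symmetric about the vertical lines through the crests and troughs, and $\eta$ is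 (weakly) monotone between each neighbouring crest and trough (these lie half a period apart). **Proposition 3.3.** Let $\omega$ be as above and $r>R_c$. 1. There is a constant $C_1>0$, depending only on $r$ and $\omega$, such that every Stokes wave $(\psi,\eta)$ with vorticity function $\omega$ and Bernoulli constant $r$ satisfies $$\psi_y(x_2,\eta(x_2))-\psi_y(x_1,\eta(x_1))\le C_1\,(\eta(x_2)-\eta(x_1))$$ for all $x_1<x_2$ such that $\eta'\ge0$ on $(x_1,x_2)$. 2. If in addition $\omega\ge0$ on $[0,1]$, then there are constants $C_2,C_3>0$, depending only on $r$ and $\omega$, such that every such Stokes wave satisfies, for all $x\in\mathbb R$, $$\psi_y(x,\eta(x))\ge\begin{cases}C_2\,(r-\eta(x)), & r-\max\eta\le\tfrac12,\\ 1, & r-\max\eta>\tfrac12,\end{cases}\qquad\text{and}\qquad |\eta'(x)|^2\le C_3\,(r-\eta(x))^{-1}.$$ Hence no wave breaking occurs before stagnation: for every $\delta>0$ there is a constant $M$, depending only on $r$, $\omega$ and $\delta$, such that $|\eta'|\le M$ on $\mathbb R$ for every such Stokes wave with $\max\eta\le r-\delta$. -/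

import Mathlib

open scoped NNReal

noncomputable section

namespace WaterWave

/-- `ω ∈ C^{1,γ}([0,1])`: continuously differentiable on `[0,1]` (one-sided at the endpoints),
with `γ`-Hölder derivative. -/
def VorticityClass (γ : ℝ≥0) (ω : ℝ → ℝ) : Prop :=
  ContDiffOn ℝ 1 ω (Set.Icc 0 1) ∧
    ∃ K : ℝ≥0, HolderOnWith K γ (derivWithin ω (Set.Icc 0 1)) (Set.Icc 0 1)

/-- `Ω(p) = ∫₀ᵖ ω`. -/
def vorticityPrimitive (ω : ℝ → ℝ) (p : ℝ) : ℝ :=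
  ∫ t in (0 : ℝ)..p, ω t

/-- The depth `d(s)` of the laminar flow with bottom speed `s`. -/
def laminarDepth (ω : ℝ → ℝ) (s : ℝ) : ℝ :=
  ∫ p in (0 : ℝ)..1, 1 / Real.sqrt (s ^ 2 - 2 * vorticityPrimitive ω p)

/-- The Bernoulli constant `R(s)` of the laminar flow with bottom speed `s`. -/
def laminarBernoulli (ω : ℝ → ℝ) (s : ℝ) : ℝ :=
  s ^ 2 / 2 - vorticityPrimitive ω 1 + laminarDepth ω s

/-- The admissible bottom speeds, `s > 0` and `s² > s₀² = max_{[0,1]} 2Ω`. -/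
def laminarSpeeds (ω : ℝ → ℝ) : Set ℝ :=
  {s | 0 < s ∧ ∀ p ∈ Set.Icc (0 : ℝ) 1, 2 * vorticityPrimitive ω p < s ^ 2}

/-- `R_c`, the smallest Bernoulli constant among laminar flows. -/
def criticalBernoulli (ω : ℝ → ℝ) : ℝ :=
  sInf (laminarBernoulli ω '' laminarSpeeds ω)

/-- The closed fluid region `0 ≤ y ≤ η(x)`; for continuous `η > 0` this is the closure of
`D_η = {0 < y < η(x)}`. -/
def fluidRegion (η : ℝ → ℝ) : Set (ℝ × ℝ) :=
  {z | 0 ≤ z.2 ∧ z.2 ≤ η z.1}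

/-- `ψ_x` on the closed fluid region, boundary included. -/
def partialX (η : ℝ → ℝ) (ψ : ℝ × ℝ → ℝ) (z : ℝ × ℝ) : ℝ :=
  fderivWithin ℝ ψ (fluidRegion η) z (1, 0)

/-- `ψ_y` on the closed fluid region, boundary included. -/
def partialY (η : ℝ → ℝ) (ψ : ℝ × ℝ → ℝ) (z : ℝ × ℝ) : ℝ :=
  fderivWithin ℝ ψ (fluidRegion η) z (0, 1)

/-- `Δψ` at a point of the open fluid domain. -/
def planeLaplacian (ψ : ℝ × ℝ → ℝ) (z : ℝ × ℝ) : ℝ :=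
  iteratedDeriv 2 (fun s => ψ (s, z.2)) z.1 + iteratedDeriv 2 (fun t => ψ (z.1, t)) z.2

/-- `(ψ, η)` is a classical solution, of class `C^{2,γ}` up to the boundary, of the
water-wave problem with vorticity function `ω` and Bernoulli constant `r`, without stagnation
points (`ψ_y > 0`). Only the values of `ψ` on the closed fluid region matter. -/
structure IsSolution (γ : ℝ≥0) (ω : ℝ → ℝ) (r : ℝ) (ψ : ℝ × ℝ → ℝ) (η : ℝ → ℝ) : Prop where
  depth_pos : ∀ x, 0 < η x
  contDiff_surface : ContDiff ℝ 2 η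
  holder_surface : ∃ K : ℝ≥0, HolderWith K γ (iteratedDeriv 2 η)
  contDiffOn_stream : ContDiffOn ℝ 2 ψ (fluidRegion η)
  holder_stream : ∃ K : ℝ≥0,
    HolderOnWith K γ (iteratedFDerivWithin ℝ 2 ψ (fluidRegion η)) (fluidRegion η)
  vorticity_eq : ∀ x y, 0 < y → y < η x → planeLaplacian ψ (x, y) + ω (ψ (x, y)) = 0
  bernoulli : ∀ x,
    (partialX η ψ (x, η x) ^ 2 + partialY η ψ (x, η x) ^ 2) / 2 + η x = r
  kinematic_top : ∀ x, ψ (x, η x) = 1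
  kinematic_bottom : ∀ x, ψ (x, 0) = 0
  unidirectional : ∀ z ∈ fluidRegion η, 0 < partialY η ψ z

/-- A Stokes wave: a solution that is periodic in `x` (period `Λ`), symmetric about the vertical
line through a crest `x = a`, and with a surface that is monotone from that crest to the
neighbouring trough `x = a + Λ / 2`. Periodicity and this symmetry give the symmetry about, and
the monotonicity between, all the lines `x = a + nΛ/2`. -/
def IsStokesWave (γ : ℝ≥0) (ω : ℝ → ℝ) (r : ℝ) (ψ : ℝ × ℝ → ℝ) (η : ℝ → ℝ) : Prop :=
  IsSolution γ ω r ψ η ∧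
    ∃ Λ a : ℝ, 0 < Λ ∧
      (∀ x, η (x + Λ) = η x) ∧
      (∀ x y, (x, y) ∈ fluidRegion η → ψ (x + Λ, y) = ψ (x, y)) ∧
      (∀ x, η (2 * a - x) = η x) ∧
      (∀ x y, (x, y) ∈ fluidRegion η → ψ (2 * a - x, y) = ψ (x, y)) ∧
      AntitoneOn η (Set.Icc a (a + Λ / 2))

end WaterWave

end

open scoped NNReal

namespace WaterWave

open Set Filter Topology

/-! The engine is a maximum principle for the total head H = |∇ψ|²/2 + K(ψ) + y with K' = ω + c,
where c is a free constant. On the free surface H equals r + K(1). If H is maximal there, then H_y ≥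
0 on the surface; combined with the Bernoulli law differentiated along the surface, this gives d/dx
ψ_y(x, η(x)) = κ η'(x) with κ ≤ c (`IsSolution.hasDerivAt_partialY_surface`).

The maximum is on the surface (`IsSolution.totalHead_le`) if 1 + cψ_y > 0, which excludes the bed,
and if the source c(ω + 2c)|∇ψ|² + 2(1 + (ω + 2c)ψ_y) is positive, which excludes the interior
(`source_nonpos_of_isLocalMax`). A large positive c always works and yields the first claim. If ω ≥
0, c = 0 works and bounds the speed; that bound makes c = -ε admissible for small ε. Then ψ_y + εη
is least at the crest, where ψ_y² = 2(r - η), and this bounds ψ_y from below everywhere; the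
Bernoulli law turns it into a slope bound.

The analytic difficulty is that ψ is only C², so H is only C¹ and has no classical Laplacian. The
elliptic inequality is therefore tested at a maximum point in the viscosity sense, by difference
quotients (`fderiv_add_planeLaplacian_nonpos_of_isLocalMax`). -/

/-! ### Second derivative test and calculus of the plane Laplacian. -/

theorem iteratedDeriv_two_eq_of_eventually_hasDerivAt {g g' : ℝ → ℝ} {t c : ℝ}
    (h : ∀ᶠ s in 𝓝 t, HasDerivAt g (g' s) s) (h' : HasDerivAt g' c t) :
    iteratedDeriv 2 g t = c := by
  have e : deriv g =ᶠ[𝓝 t] g' := h.mono fun s hs => hs.deriv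
  rw [iteratedDeriv_succ, iteratedDeriv_one, e.deriv_eq, h'.deriv]

/-- A positive second derivative would make the point a local minimum too, so the function would be
locally constant, with vanishing second derivative. -/
theorem second_deriv_nonpos_of_isLocalMax {g g' : ℝ → ℝ} {t c : ℝ}
    (h : ∀ᶠ s in 𝓝 t, HasDerivAt g (g' s) s) (h' : HasDerivAt g' c t) (hmax : IsLocalMax g t) :
    c ≤ 0 := by
  by_contra! hc
  have e : deriv g =ᶠ[𝓝 t] g' := h.mono fun s hs => hs.deriv
  have h2 : deriv (deriv g) t = c := by rw [e.deriv_eq, h'.deriv]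
  have hmin : IsLocalMin g t :=
    isLocalMin_of_deriv_deriv_pos (by rw [h2]; exact hc) hmax.deriv_eq_zero
      h.self_of_nhds.continuousAt
  have hconst : g =ᶠ[𝓝 t] fun _ => g t := by
    filter_upwards [hmax, hmin] with s h1 h2 using le_antisymm h1 h2
  have : deriv (deriv g) t = 0 := by
    rw [(hconst.deriv).deriv_eq]; simp
  linarith

theorem hasDerivAt_mk_left (x y : ℝ) : HasDerivAt (fun s : ℝ => (s, y)) ((1 : ℝ), (0 : ℝ)) x :=
  (hasDerivAt_id x).prodMk (hasDerivAt_const x y)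

theorem hasDerivAt_mk_right (x y : ℝ) : HasDerivAt (fun t : ℝ => (x, t)) ((0 : ℝ), (1 : ℝ)) y :=
  (hasDerivAt_const y x).prodMk (hasDerivAt_id y)

theorem eventually_differentiableAt_of_contDiffAt_two {f : ℝ × ℝ → ℝ} {z : ℝ × ℝ}
    (hf : ContDiffAt ℝ 2 f z) : ∀ᶠ w in 𝓝 z, DifferentiableAt ℝ f w :=
  (hf.eventually (by simp)).mono fun _ hw => hw.differentiableAt (by simp)

theorem differentiableAt_fderiv_of_contDiffAt_two {f : ℝ × ℝ → ℝ} {z : ℝ × ℝ}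
    (hf : ContDiffAt ℝ 2 f z) : DifferentiableAt ℝ (fderiv ℝ f) z :=
  (hf.fderiv_right (m := 1) (by norm_num)).differentiableAt (by simp)

/-- First and second derivatives of a `C²` function along a horizontal line. -/
theorem hasDerivAt_section_left {f : ℝ × ℝ → ℝ} {z : ℝ × ℝ} (hf : ContDiffAt ℝ 2 f z) :
    (∀ᶠ s in 𝓝 z.1, HasDerivAt (fun s => f (s, z.2)) (fderiv ℝ f (s, z.2) (1, 0)) s) ∧
      HasDerivAt (fun s => fderiv ℝ f (s, z.2) (1, 0))
        (fderiv ℝ (fderiv ℝ f) z (1, 0) (1, 0)) z.1 := by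
  constructor
  · have hc : ContinuousAt (fun s : ℝ => (s, z.2)) z.1 :=
      (hasDerivAt_mk_left z.1 z.2).continuousAt
    filter_upwards [hc.eventually (eventually_differentiableAt_of_contDiffAt_two hf)] with s hs
    exact hs.hasFDerivAt.comp_hasDerivAt s (hasDerivAt_mk_left s z.2)
  · have h := (differentiableAt_fderiv_of_contDiffAt_two hf).hasFDerivAt.comp_hasDerivAt z.1
      (hasDerivAt_mk_left z.1 z.2)
    exact (HasDerivAt.clm_apply h (hasDerivAt_const z.1 ((1 : ℝ), (0 : ℝ)))).congr_deriv (by simp)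

theorem hasDerivAt_section_right {f : ℝ × ℝ → ℝ} {z : ℝ × ℝ} (hf : ContDiffAt ℝ 2 f z) :
    (∀ᶠ t in 𝓝 z.2, HasDerivAt (fun t => f (z.1, t)) (fderiv ℝ f (z.1, t) (0, 1)) t) ∧
      HasDerivAt (fun t => fderiv ℝ f (z.1, t) (0, 1))
        (fderiv ℝ (fderiv ℝ f) z (0, 1) (0, 1)) z.2 := by
  constructor
  · have hc : ContinuousAt (fun t : ℝ => (z.1, t)) z.2 :=
      (hasDerivAt_mk_right z.1 z.2).continuousAt
    filter_upwards [hc.eventually (eventually_differentiableAt_of_contDiffAt_two hf)] with t ht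
    exact ht.hasFDerivAt.comp_hasDerivAt t (hasDerivAt_mk_right z.1 t)
  · have h := (differentiableAt_fderiv_of_contDiffAt_two hf).hasFDerivAt.comp_hasDerivAt z.2
      (hasDerivAt_mk_right z.1 z.2)
    exact (HasDerivAt.clm_apply h (hasDerivAt_const z.2 ((0 : ℝ), (1 : ℝ)))).congr_deriv (by simp)

theorem planeLaplacian_eq_fderiv {f : ℝ × ℝ → ℝ} {z : ℝ × ℝ} (hf : ContDiffAt ℝ 2 f z) :
    planeLaplacian f z = fderiv ℝ (fderiv ℝ f) z (1, 0) (1, 0) +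
      fderiv ℝ (fderiv ℝ f) z (0, 1) (0, 1) := by
  obtain ⟨h1, h2⟩ := hasDerivAt_section_left hf
  obtain ⟨h3, h4⟩ := hasDerivAt_section_right hf
  rw [planeLaplacian, iteratedDeriv_two_eq_of_eventually_hasDerivAt h1 h2,
    iteratedDeriv_two_eq_of_eventually_hasDerivAt h3 h4]

theorem continuousAt_planeLaplacian {f : ℝ × ℝ → ℝ} {z : ℝ × ℝ} (hf : ContDiffAt ℝ 2 f z) :
    ContinuousAt (planeLaplacian f) z := by
  have h : ContinuousAt (fderiv ℝ (fderiv ℝ f)) z :=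
    ((hf.fderiv_right (m := 1) (by norm_num)).fderiv_right (m := 0) (by norm_num)).continuousAt
  have e : planeLaplacian f =ᶠ[𝓝 z] fun w => fderiv ℝ (fderiv ℝ f) w (1, 0) (1, 0) +
      fderiv ℝ (fderiv ℝ f) w (0, 1) (0, 1) :=
    (hf.eventually (by simp)).mono fun w hw => planeLaplacian_eq_fderiv hw
  refine ContinuousAt.congr ?_ e.symm
  exact ((h.clm_apply continuousAt_const).clm_apply continuousAt_const).add
    ((h.clm_apply continuousAt_const).clm_apply continuousAt_const)

theorem planeLaplacian_nonpos_of_isLocalMax {f : ℝ × ℝ → ℝ} {z : ℝ × ℝ}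
    (hf : ContDiffAt ℝ 2 f z) (hmax : IsLocalMax f z) : planeLaplacian f z ≤ 0 := by
  obtain ⟨h1, h2⟩ := hasDerivAt_section_left hf
  obtain ⟨h3, h4⟩ := hasDerivAt_section_right hf
  rw [planeLaplacian_eq_fderiv hf]
  refine add_nonpos (second_deriv_nonpos_of_isLocalMax h1 h2 ?_)
    (second_deriv_nonpos_of_isLocalMax h3 h4 ?_)
  · exact (hasDerivAt_mk_left z.1 z.2).continuousAt.eventually hmax
  · exact (hasDerivAt_mk_right z.1 z.2).continuousAt.eventually hmax

theorem contDiffAt_section_left {f : ℝ × ℝ → ℝ} {z : ℝ × ℝ} (hf : ContDiffAt ℝ 2 f z) :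
    ContDiffAt ℝ 2 (fun s => f (s, z.2)) z.1 :=
  ContDiffAt.comp (g := f) (f := fun s : ℝ => (s, z.2)) z.1 hf
    (contDiffAt_id.prodMk contDiffAt_const)

theorem contDiffAt_section_right {f : ℝ × ℝ → ℝ} {z : ℝ × ℝ} (hf : ContDiffAt ℝ 2 f z) :
    ContDiffAt ℝ 2 (fun t => f (z.1, t)) z.2 :=
  ContDiffAt.comp (g := f) (f := fun t : ℝ => (z.1, t)) z.2 hf
    (contDiffAt_const.prodMk contDiffAt_id)

theorem planeLaplacian_add {f g : ℝ × ℝ → ℝ} {z : ℝ × ℝ}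
    (hf : ContDiffAt ℝ 2 f z) (hg : ContDiffAt ℝ 2 g z) :
    planeLaplacian (fun w => f w + g w) z = planeLaplacian f z + planeLaplacian g z := by
  have h1 := iteratedDeriv_fun_add (contDiffAt_section_left hf) (contDiffAt_section_left hg)
  have h2 := iteratedDeriv_fun_add (contDiffAt_section_right hf) (contDiffAt_section_right hg)
  simp only [planeLaplacian]
  rw [h1, h2]
  ring

theorem planeLaplacian_const_mul (c : ℝ) (f : ℝ × ℝ → ℝ) (z : ℝ × ℝ) :
    planeLaplacian (fun w => c * f w) z = c * planeLaplacian f z := by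
  simp only [planeLaplacian]
  rw [iteratedDeriv_const_mul_field, iteratedDeriv_const_mul_field]
  ring

theorem planeLaplacian_comp_add_const (f : ℝ × ℝ → ℝ) (w z : ℝ × ℝ) :
    planeLaplacian (fun z => f (z + w)) z = planeLaplacian f (z + w) := by
  have h1 := congrFun (iteratedDeriv_comp_add_const 2 (fun s => f (s, z.2 + w.2)) w.1) z.1
  have h2 := congrFun (iteratedDeriv_comp_add_const 2 (fun t => f (z.1 + w.1, t)) w.2) z.2
  simp only [planeLaplacian, Prod.fst_add, Prod.snd_add] at *
  rw [← h1, ← h2]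
  rfl

theorem planeLaplacian_quadratic (a b c : ℝ) (z₀ z : ℝ × ℝ) :
    planeLaplacian (fun w => a * (w.1 - z₀.1) ^ 2 + b * ((w.1 - z₀.1) * (w.2 - z₀.2)) +
      c * (w.2 - z₀.2) ^ 2) z = 2 * a + 2 * c := by
  have h1 : iteratedDeriv 2 (fun s : ℝ => a * (s - z₀.1) ^ 2 + b * ((s - z₀.1) * (z.2 - z₀.2)) +
      c * (z.2 - z₀.2) ^ 2) z.1 = 2 * a := by
    apply iteratedDeriv_two_eq_of_eventually_hasDerivAt
      (g' := fun s => a * (2 * (s - z₀.1)) + b * (z.2 - z₀.2))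
    · refine Eventually.of_forall fun s => ?_
      have h := (hasDerivAt_id' s).sub_const z₀.1
      exact ((((h.pow 2).const_mul a).add ((h.mul_const (z.2 - z₀.2)).const_mul b)).add_const
        (c * (z.2 - z₀.2) ^ 2)).congr_deriv (by simp)
    · exact (((((hasDerivAt_id' z.1).sub_const z₀.1).const_mul 2).const_mul a).add_const
        (b * (z.2 - z₀.2))).congr_deriv (by ring)
  have h2 : iteratedDeriv 2 (fun t : ℝ => a * (z.1 - z₀.1) ^ 2 + b * ((z.1 - z₀.1) * (t - z₀.2)) +
      c * (t - z₀.2) ^ 2) z.2 = 2 * c := by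
    apply iteratedDeriv_two_eq_of_eventually_hasDerivAt
      (g' := fun t => b * (z.1 - z₀.1) + c * (2 * (t - z₀.2)))
    · refine Eventually.of_forall fun t => ?_
      have h := (hasDerivAt_id' t).sub_const z₀.2
      exact (((((h.const_mul (z.1 - z₀.1)).const_mul b).const_add (a * (z.1 - z₀.1) ^ 2)).add
        ((h.pow 2).const_mul c))).congr_deriv (by simp)
    · exact (((((hasDerivAt_id' z.2).sub_const z₀.2).const_mul 2).const_mul c).const_add
        (b * (z.1 - z₀.1))).congr_deriv (by ring)
  rw [planeLaplacian, h1, h2]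

theorem contDiff_quadratic (a b c : ℝ) (z₀ : ℝ × ℝ) :
    ContDiff ℝ 2 (fun w : ℝ × ℝ => a * (w.1 - z₀.1) ^ 2 + b * ((w.1 - z₀.1) * (w.2 - z₀.2)) +
      c * (w.2 - z₀.2) ^ 2) := by
  fun_prop

/-! ### The differentiated Poisson equation in the viscosity sense. -/

/-- A `C²` function whose Laplacian is `C¹` has directional derivatives that satisfy the
differentiated Poisson equation in the viscosity sense, although they are only `C¹`. -/
theorem fderiv_add_planeLaplacian_nonpos_of_isLocalMax {U : Set (ℝ × ℝ)} (hU : IsOpen U)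
    {ψ f q : ℝ × ℝ → ℝ} {z₀ v : ℝ × ℝ} (hz : z₀ ∈ U) (hψ : ContDiffOn ℝ 2 ψ U)
    (hf : ContDiffAt ℝ 1 f z₀) (hq : ContDiffAt ℝ 2 q z₀)
    (hlap : ∀ z ∈ U, planeLaplacian ψ z = f z)
    (hmax : IsLocalMax (fun z => fderiv ℝ ψ z v + q z) z₀) :
    fderiv ℝ f z₀ v + planeLaplacian q z₀ ≤ 0 := by
  by_contra! hpos
  -- Of the excess 8m, the paraboloid `Q` takes 4m, the variation of Δq takes m and the difference
  -- quotient of `f` takes m; 2m remains for the contradiction.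
  obtain ⟨m, hm, hm8⟩ : ∃ m > 0, fderiv ℝ f z₀ v + planeLaplacian q z₀ = 8 * m :=
    ⟨(fderiv ℝ f z₀ v + planeLaplacian q z₀) / 8, by positivity, by ring⟩
  -- a neighbourhood on which all local estimates hold
  obtain ⟨L, s, hs, hL⟩ := (hq.of_le (by norm_num : (1 : WithTop ℕ∞) ≤ 2)).exists_lipschitzOnWith
  have hε : 0 < m / (‖v‖ + 1) := by positivity
  -- Strict differentiability is needed because `f` is compared at two moving points, z₁ and z₁ +
  -- hv.
  have hstrict := (hf.hasStrictFDerivAt (by simp)).isLittleO.def hε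
  rw [nhds_prod_eq] at hstrict
  obtain ⟨T, hT, hfT⟩ := mem_prod_self_iff.1 hstrict
  have hev : ∀ᶠ z in 𝓝 z₀, z ∈ U ∧ fderiv ℝ ψ z v + q z ≤ fderiv ℝ ψ z₀ v + q z₀ ∧
      planeLaplacian q z₀ - m < planeLaplacian q z ∧ z ∈ s ∧ z ∈ T ∧ ContDiffAt ℝ 2 q z := by
    filter_upwards [hU.mem_nhds hz, hmax,
      (continuousAt_planeLaplacian hq).eventually (lt_mem_nhds (sub_lt_self _ hm)), hs,
      hT, hq.eventually (by simp)] with z h1 h2 h3 h4 h5 h6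
    exact ⟨h1, h2, h3, h4, h5, h6⟩
  obtain ⟨ρ', hρ', hball⟩ := Metric.eventually_nhds_iff_ball.1 hev
  obtain ⟨ρ, hρ, rfl⟩ : ∃ ρ > 0, ρ' = 2 * ρ := ⟨ρ' / 2, by positivity, by ring⟩
  -- choice of the increment
  have hd0 : HasDerivAt (fun h : ℝ => ψ (z₀ + h • v)) (fderiv ℝ ψ z₀ v) 0 := by
    have h1 : HasFDerivAt ψ (fderiv ℝ ψ z₀) (z₀ + (0 : ℝ) • v) := by
      rw [zero_smul, add_zero]
      exact ((hψ.contDiffAt (hU.mem_nhds hz)).differentiableAt (by simp)).hasFDerivAt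
    have h2 : HasDerivAt (fun h : ℝ => z₀ + h • v) v 0 := by
      simpa using ((hasDerivAt_id (0 : ℝ)).smul_const v).const_add z₀
    exact h1.comp_hasDerivAt 0 h2
  have hslope := hasDerivAt_iff_tendsto_slope_zero.1 hd0
  -- On the boundary of the ball `Q` costs mρ²: half pays for the slope error at z₀, half for the
  -- Lipschitz error in `q`.
  have hη : 0 < m * ρ ^ 2 / 2 := by positivity
  have hev2 : ∀ᶠ h : ℝ in 𝓝[>] 0, fderiv ℝ ψ z₀ v - m * ρ ^ 2 / 2 <
      h⁻¹ • (ψ (z₀ + (0 + h) • v) - ψ (z₀ + (0 : ℝ) • v)) :=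
    (hslope.mono_left (nhdsWithin_mono _ fun x hx => ne_of_gt hx)).eventually
      (lt_mem_nhds (sub_lt_self _ hη))
  have hc1 : ∀ᶠ h : ℝ in 𝓝[>] 0, h * ‖v‖ < ρ :=
    (((continuous_id.mul continuous_const).tendsto' 0 0 (by simp)).mono_left
      nhdsWithin_le_nhds).eventually (gt_mem_nhds hρ)
  have hc2 : ∀ᶠ h : ℝ in 𝓝[>] 0, L * (h * ‖v‖) < m * ρ ^ 2 / 2 :=
    (((continuous_const.mul (continuous_id.mul continuous_const)).tendsto' 0 0
      (by simp)).mono_left nhdsWithin_le_nhds).eventually (gt_mem_nhds hη)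
  obtain ⟨h, hh1, hh2, hh3, hh⟩ := (hev2.and (hc1.and (hc2.and self_mem_nhdsWithin))).exists
  replace hh : 0 < h := hh
  simp only [zero_add, zero_smul, add_zero, smul_eq_mul] at hh1
  have hmove : ∀ z ∈ Metric.closedBall z₀ ρ, ∀ t ∈ Icc 0 h, z + t • v ∈ Metric.ball z₀ (2 * ρ) := by
    intro z hz t ht
    rw [mem_ball_iff_norm]
    rw [mem_closedBall_iff_norm] at hz
    calc ‖z + t • v - z₀‖ = ‖(z - z₀) + t • v‖ := by congr 1; abel
      _ ≤ ‖z - z₀‖ + ‖t • v‖ := norm_add_le _ _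
      _ = ‖z - z₀‖ + t * ‖v‖ := by rw [norm_smul, Real.norm_of_nonneg ht.1]
      _ ≤ ‖z - z₀‖ + h * ‖v‖ := by gcongr; exact ht.2
      _ < 2 * ρ := by linarith
  have hmem : ∀ z ∈ Metric.closedBall z₀ ρ, z ∈ Metric.ball z₀ (2 * ρ) := fun z hz => by
    simpa using hmove z hz 0 ⟨le_rfl, hh.le⟩
  have hψat : ∀ z ∈ Metric.ball z₀ (2 * ρ), ContDiffAt ℝ 2 ψ z := fun z hz =>
    hψ.contDiffAt (hU.mem_nhds (hball z hz).1)
  set Q : ℝ × ℝ → ℝ := fun w => (-m) * (w.1 - z₀.1) ^ 2 + 0 * ((w.1 - z₀.1) * (w.2 - z₀.2)) +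
      (-m) * (w.2 - z₀.2) ^ 2 with hQ
  set D : ℝ × ℝ → ℝ := fun z => h⁻¹ * (ψ (z + h • v) + (-1) * ψ z) with hD
  set H : ℝ × ℝ → ℝ := fun z => D z + (q z + Q z) with hH
  have hψsh : ∀ z ∈ Metric.closedBall z₀ ρ, ContDiffAt ℝ 2 (fun z => ψ (z + h • v)) z := by
    intro z hz
    exact ContDiffAt.comp (g := ψ) (f := fun z => z + h • v) z
      (hψat _ (hmove z hz h ⟨hh.le, le_rfl⟩)) (contDiffAt_id.add contDiffAt_const)
  have hDat : ∀ z ∈ Metric.closedBall z₀ ρ, ContDiffAt ℝ 2 D z := fun z hz =>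
    contDiffAt_const.mul ((hψsh z hz).add (contDiffAt_const.mul (hψat z (hmem z hz))))
  have hQat : ∀ z, ContDiffAt ℝ 2 Q z := fun z => (contDiff_quadratic _ _ _ z₀).contDiffAt
  have hHat : ∀ z ∈ Metric.closedBall z₀ ρ, ContDiffAt ℝ 2 H z := fun z hz =>
    (hDat z hz).add ((hball z (hmem z hz)).2.2.2.2.2.add (hQat z))
  -- the maximum of `H` over the ball is attained in its interior
  obtain ⟨z₁, hz₁, hz₁max⟩ := (isCompact_closedBall z₀ ρ).exists_isMaxOn
    ⟨z₀, Metric.mem_closedBall_self hρ.le⟩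
    (fun z hz => (hHat z hz).continuousAt.continuousWithinAt)
  have hz₁ball : z₁ ∈ Metric.ball z₀ ρ := by
    by_contra hnot
    have hn : ‖z₁ - z₀‖ = ρ := by
      rw [mem_ball_iff_norm, not_lt] at hnot
      exact le_antisymm (mem_closedBall_iff_norm.1 hz₁) hnot
    have h0 : H z₀ ≤ H z₁ := hz₁max (Metric.mem_closedBall_self hρ.le)
    have hQ0 : Q z₀ = 0 := by simp [hQ]
    have hQ1 : Q z₁ ≤ -(m * ρ ^ 2) := by
      -- The norm on ℝ × ℝ is the sup norm, which the Euclidean one dominates.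
      have : ρ ^ 2 ≤ (z₁.1 - z₀.1) ^ 2 + (z₁.2 - z₀.2) ^ 2 := by
        rw [← hn, Prod.norm_def]
        rcases max_cases ‖(z₁ - z₀).1‖ ‖(z₁ - z₀).2‖ with ⟨e, -⟩ | ⟨e, -⟩ <;>
        · rw [e, Real.norm_eq_abs, sq_abs]
          simp only [Prod.fst_sub, Prod.snd_sub]
          nlinarith [sq_nonneg (z₁.1 - z₀.1), sq_nonneg (z₁.2 - z₀.2)]
      simp only [hQ]
      nlinarith
    have hD1 : D z₁ + q z₁ ≤ fderiv ℝ ψ z₀ v + q z₀ + L * (h * ‖v‖) := by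
      have hder : ∀ t ∈ Icc 0 h, HasDerivAt (fun t : ℝ => ψ (z₁ + t • v))
          (fderiv ℝ ψ (z₁ + t • v) v) t := by
        intro t ht
        have h1 := ((hψat _ (hmove z₁ hz₁ t ht)).differentiableAt (by simp)).hasFDerivAt
        have h2 : HasDerivAt (fun t : ℝ => z₁ + t • v) v t := by
          simpa using ((hasDerivAt_id t).smul_const v).const_add z₁
        exact h1.comp_hasDerivAt t h2
      -- By the mean value theorem the difference quotient at z₁ is the directional derivative at z₁
      -- + tv, where the local maximum hypothesis applies; `q` is then moved back to z₁.
      obtain ⟨t, ht, hslope⟩ := exists_hasDerivAt_eq_slope (fun t : ℝ => ψ (z₁ + t • v))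
        (fun t => fderiv ℝ ψ (z₁ + t • v) v) hh
        (fun t ht => (hder t ht).continuousAt.continuousWithinAt)
        (fun t ht => hder t (Ioo_subset_Icc_self ht))
      have ht' := Ioo_subset_Icc_self ht
      have hDt : D z₁ = fderiv ℝ ψ (z₁ + t • v) v := by
        rw [hslope]
        simp only [hD, zero_smul, add_zero, sub_zero]
        field_simp
        ring
      have hb1 := hball _ (hmove z₁ hz₁ t ht')
      have hb2 := hball _ (hmem z₁ hz₁)
      have hlip := hL.dist_le_mul _ hb2.2.2.2.1 _ hb1.2.2.2.1
      rw [Real.dist_eq, dist_eq_norm] at hlip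
      have hnorm : ‖z₁ - (z₁ + t • v)‖ ≤ h * ‖v‖ := by
        rw [sub_add_cancel_left, norm_neg, norm_smul, Real.norm_of_nonneg ht'.1]
        gcongr
        exact ht'.2
      have hle : (L : ℝ) * ‖z₁ - (z₁ + t • v)‖ ≤ L * (h * ‖v‖) := by gcongr
      have := (abs_le.1 hlip).2
      rw [hDt]
      linarith [hb1.2.1]
    have hD0 : fderiv ℝ ψ z₀ v - m * ρ ^ 2 / 2 < D z₀ := by
      simpa only [hD, neg_one_mul, ← sub_eq_add_neg] using hh1
    simp only [hH] at h0
    linarith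
  have hloc : IsLocalMax H z₁ :=
    hz₁max.isLocalMax (mem_of_superset (Metric.isOpen_ball.mem_nhds hz₁ball)
      Metric.ball_subset_closedBall)
  have hle := planeLaplacian_nonpos_of_isLocalMax (hHat z₁ hz₁) hloc
  have hb1 := hball _ (hmem z₁ hz₁)
  have hb2 := hball _ (hmove z₁ hz₁ h ⟨hh.le, le_rfl⟩)
  have hlapH : planeLaplacian H z₁ = h⁻¹ * (f (z₁ + h • v) - f z₁) + planeLaplacian q z₁ - 4 * m := by
    rw [hH, planeLaplacian_add (hDat z₁ hz₁) (hb1.2.2.2.2.2.add (hQat z₁)),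
      planeLaplacian_add hb1.2.2.2.2.2 (hQat z₁), hQ, planeLaplacian_quadratic, hD,
      planeLaplacian_const_mul, planeLaplacian_add (hψsh z₁ hz₁)
        (contDiffAt_const.mul (hψat z₁ (hmem z₁ hz₁))), planeLaplacian_const_mul,
      planeLaplacian_comp_add_const, hlap _ hb1.1, hlap _ hb2.1]
    ring
  have hfd := hfT (Set.mk_mem_prod hb2.2.2.2.2.1 hb1.2.2.2.2.1)
  simp only [mem_ofPred_eq, add_sub_cancel_left, map_smul, smul_eq_mul, norm_smul] at hfd
  rw [Real.norm_eq_abs, Real.norm_of_nonneg hh.le] at hfd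
  have hsmall : m / (‖v‖ + 1) * (h * ‖v‖) ≤ h * m := by
    rw [div_mul_eq_mul_div, div_le_iff₀ (by positivity)]
    nlinarith [norm_nonneg v, mul_pos hh hm]
  have hlow : fderiv ℝ f z₀ v - m ≤ h⁻¹ * (f (z₁ + h • v) - f z₁) := by
    rw [← div_eq_inv_mul, le_div_iff₀ hh]
    nlinarith [(abs_le.1 (hfd.trans hsmall)).1]
  linarith [hb1.2.2.1]

/-! ### The elliptic inequality at an interior maximum of the total head. -/

theorem iteratedDeriv_two_comp {u u' K k : ℝ → ℝ} {t c k' : ℝ}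
    (hu : ∀ᶠ s in 𝓝 t, HasDerivAt u (u' s) s) (hu' : HasDerivAt u' c t)
    (hK : ∀ᶠ p in 𝓝 (u t), HasDerivAt K (k p) p) (hk : HasDerivAt k k' (u t)) :
    iteratedDeriv 2 (fun s => K (u s)) t = k' * u' t ^ 2 + k (u t) * c := by
  have hc := hu.self_of_nhds.continuousAt
  refine iteratedDeriv_two_eq_of_eventually_hasDerivAt (g' := fun s => k (u s) * u' s) ?_ ?_
  · filter_upwards [hu, hc.eventually hK] with s h1 h2 using h2.comp s h1
  · exact ((hk.comp t hu.self_of_nhds).mul hu').congr_deriv (by simp only [Function.comp]; ring)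

theorem planeLaplacian_comp {ψ : ℝ × ℝ → ℝ} {K k : ℝ → ℝ} {z : ℝ × ℝ} {k' : ℝ}
    (hψ : ContDiffAt ℝ 2 ψ z) (hK : ∀ᶠ p in 𝓝 (ψ z), HasDerivAt K (k p) p)
    (hk : HasDerivAt k k' (ψ z)) :
    planeLaplacian (fun w => K (ψ w)) z =
      k' * (fderiv ℝ ψ z (1, 0) ^ 2 + fderiv ℝ ψ z (0, 1) ^ 2) + k (ψ z) * planeLaplacian ψ z := by
  obtain ⟨h1, h2⟩ := hasDerivAt_section_left hψ
  obtain ⟨h3, h4⟩ := hasDerivAt_section_right hψ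
  rw [planeLaplacian_eq_fderiv hψ, planeLaplacian, iteratedDeriv_two_comp h1 h2 hK hk,
    iteratedDeriv_two_comp h3 h4 hK hk]
  ring

theorem planeLaplacian_snd (z : ℝ × ℝ) : planeLaplacian (fun w => w.2) z = 0 := by
  simp [planeLaplacian, iteratedDeriv_succ]

theorem contDiffAt_two_of_hasDerivAt {s : Set ℝ} (hs : IsOpen s) {K k : ℝ → ℝ} {p : ℝ}
    (hp : p ∈ s) (hK : ∀ p ∈ s, HasDerivAt K (k p) p) (hk : ContDiffOn ℝ 1 k s) :
    ContDiffAt ℝ 2 K p := by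
  have h : ContDiffOn ℝ (1 + 1) K s := by
    rw [contDiffOn_succ_iff_deriv_of_isOpen hs]
    exact ⟨fun x hx => (hK x hx).differentiableAt.differentiableWithinAt, by simp,
      hk.congr fun x hx => (hK x hx).deriv⟩
  rw [one_add_one_eq_two] at h
  exact h.contDiffAt (hs.mem_nhds hp)

/-- Tangent quadratic minorant of `|∇ψ|² / 2` at the second order. -/
theorem eventually_quadratic_le_gradient_sq {ψ : ℝ × ℝ → ℝ} {z₀ : ℝ × ℝ}
    (hψ : ContDiffAt ℝ 2 ψ z₀) {p q a b d ε : ℝ} (hp : fderiv ℝ ψ z₀ (1, 0) = p)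
    (hq : fderiv ℝ ψ z₀ (0, 1) = q)
    (ha : fderiv ℝ (fderiv ℝ ψ) z₀ (1, 0) (1, 0) = a)
    (hb : fderiv ℝ (fderiv ℝ ψ) z₀ (1, 0) (0, 1) = b)
    (hb' : fderiv ℝ (fderiv ℝ ψ) z₀ (0, 1) (1, 0) = b)
    (hd : fderiv ℝ (fderiv ℝ ψ) z₀ (0, 1) (0, 1) = d) (hε : 0 < ε) :
    ∀ᶠ z in 𝓝 z₀, (((a ^ 2 + b ^ 2) / 2 - ε) * (z.1 - z₀.1) ^ 2 +
      (a * b + b * d) * ((z.1 - z₀.1) * (z.2 - z₀.2)) +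
      ((b ^ 2 + d ^ 2) / 2 - ε) * (z.2 - z₀.2) ^ 2) ≤
      ((fderiv ℝ ψ z (1, 0) - p) ^ 2 + (fderiv ℝ ψ z (0, 1) - q) ^ 2) / 2 := by
  set M := |a| + 2 * |b| + |d| + 1 with hM
  have hMpos : 0 < M := by positivity
  have ho := (differentiableAt_fderiv_of_contDiffAt_two hψ).hasFDerivAt.isLittleO.def
    (by positivity : 0 < ε / (2 * M))
  filter_upwards [ho] with z hz
  set w := z - z₀ with hw
  have hw1 : z.1 - z₀.1 = w.1 := rfl
  have hw2 : z.2 - z₀.2 = w.2 := rfl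
  set S := fderiv ℝ (fderiv ℝ ψ) z₀ with hS
  have hSw : S w = w.1 • S (1, 0) + w.2 • S (0, 1) := by
    rw [← map_smul, ← map_smul, ← map_add]
    congr 1
    ext <;> simp
  have hn1 : ‖((1 : ℝ), (0 : ℝ))‖ = 1 := by simp [Prod.norm_def]
  have hn2 : ‖((0 : ℝ), (1 : ℝ))‖ = 1 := by simp [Prod.norm_def]
  have h1 := (fderiv ℝ ψ z - fderiv ℝ ψ z₀ - S w).le_of_opNorm_le hz (1, 0)
  have h2 := (fderiv ℝ ψ z - fderiv ℝ ψ z₀ - S w).le_of_opNorm_le hz (0, 1)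
  simp only [hSw, _root_.sub_apply, _root_.add_apply,
    _root_.smul_apply, hn1, hn2, mul_one, smul_eq_mul, hp, hq, ha, hb, hb', hd,
    Real.norm_eq_abs] at h1 h2
  rw [hw1, hw2]
  set α := fderiv ℝ ψ z (1, 0) - p
  set β := fderiv ℝ ψ z (0, 1) - q
  set N := ‖w‖ with hN
  have hN0 : 0 ≤ N := norm_nonneg w
  have hwn1 : |w.1| ≤ N := norm_fst_le w
  have hwn2 : |w.2| ≤ N := norm_snd_le w
  have hNsq : N ^ 2 ≤ w.1 ^ 2 + w.2 ^ 2 := by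
    rw [hN, Prod.norm_def]
    rcases max_cases ‖w.1‖ ‖w.2‖ with ⟨e, -⟩ | ⟨e, -⟩ <;>
    · rw [e, Real.norm_eq_abs, sq_abs]
      nlinarith [sq_nonneg w.1, sq_nonneg w.2]
  have hbd : ∀ s t : ℝ, |s| + |t| ≤ M → |w.1 * s + w.2 * t| ≤ M * N := by
    intro s t hst
    calc |w.1 * s + w.2 * t| ≤ |w.1 * s| + |w.2 * t| := abs_add_le _ _
      _ = |w.1| * |s| + |w.2| * |t| := by rw [abs_mul, abs_mul]
      _ ≤ N * |s| + N * |t| := by gcongr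
      _ = (|s| + |t|) * N := by ring
      _ ≤ M * N := by gcongr
  have hβ1 := hbd a b (by rw [hM]; linarith [abs_nonneg b, abs_nonneg d])
  have hβ2 := hbd b d (by rw [hM]; linarith [abs_nonneg b, abs_nonneg a])
  have hcross : ∀ s t : ℝ, |s| ≤ M * N → |t| ≤ ε / (2 * M) * N → -(ε / 2 * N ^ 2) ≤ s * t := by
    intro s t hs ht
    have : |s * t| ≤ ε / 2 * N ^ 2 := by
      rw [abs_mul]
      calc |s| * |t| ≤ (M * N) * (ε / (2 * M) * N) := by gcongr
        _ = ε / 2 * N ^ 2 := by field_simp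
    exact (abs_le.1 this).1
  have hc1 := hcross _ _ hβ1 h1
  have hc2 := hcross _ _ hβ2 h2
  have hm := mul_le_mul_of_nonneg_left hNsq hε.le
  -- A square lies above its tangent at the linear Taylor part.
  have hα : (w.1 * a + w.2 * b) ^ 2 / 2 + (w.1 * a + w.2 * b) * (α - (w.1 * a + w.2 * b)) ≤
      α ^ 2 / 2 := by nlinarith only [sq_nonneg (α - (w.1 * a + w.2 * b))]
  have hβ : (w.1 * b + w.2 * d) ^ 2 / 2 + (w.1 * b + w.2 * d) * (β - (w.1 * b + w.2 * d)) ≤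
      β ^ 2 / 2 := by nlinarith only [sq_nonneg (β - (w.1 * b + w.2 * d))]
  have e : ((a ^ 2 + b ^ 2) / 2 - ε) * w.1 ^ 2 + (a * b + b * d) * (w.1 * w.2) +
      ((b ^ 2 + d ^ 2) / 2 - ε) * w.2 ^ 2 = (w.1 * a + w.2 * b) ^ 2 / 2 +
      (w.1 * b + w.2 * d) ^ 2 / 2 - ε * (w.1 ^ 2 + w.2 ^ 2) := by ring
  rw [e]
  linarith

/-- At an interior local maximum of `|∇ψ|² / 2 + K(ψ) + y`, where `K' = ω + c`, the zero-order
term of the elliptic inequality satisfied by this function is nonpositive. -/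
theorem source_nonpos_of_isLocalMax {U : Set (ℝ × ℝ)} (hU : IsOpen U) {ψ : ℝ × ℝ → ℝ}
    {ω K : ℝ → ℝ} {c : ℝ} {z₀ : ℝ × ℝ} (hz : z₀ ∈ U) (hψ : ContDiffOn ℝ 2 ψ U)
    (hω : ContDiffOn ℝ 1 ω (Ioo 0 1)) (hK : ∀ p ∈ Ioo (0 : ℝ) 1, HasDerivAt K (ω p + c) p)
    (hrange : ∀ z ∈ U, ψ z ∈ Ioo (0 : ℝ) 1) (hlap : ∀ z ∈ U, planeLaplacian ψ z = -ω (ψ z))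
    (hmax : IsLocalMax (fun z => (fderiv ℝ ψ z (1, 0) ^ 2 + fderiv ℝ ψ z (0, 1) ^ 2) / 2 +
      K (ψ z) + z.2) z₀) :
    c * (ω (ψ z₀) + 2 * c) * (fderiv ℝ ψ z₀ (1, 0) ^ 2 + fderiv ℝ ψ z₀ (0, 1) ^ 2) +
      2 * (1 + (ω (ψ z₀) + 2 * c) * fderiv ℝ ψ z₀ (0, 1)) ≤ 0 := by
  have hψ0 : ContDiffAt ℝ 2 ψ z₀ := hψ.contDiffAt (hU.mem_nhds hz)
  have hr := hrange z₀ hz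
  have hω0 : ContDiffAt ℝ 1 ω (ψ z₀) := hω.contDiffAt (isOpen_Ioo.mem_nhds hr)
  obtain ⟨p, hp⟩ : ∃ p, fderiv ℝ ψ z₀ (1, 0) = p := ⟨_, rfl⟩
  obtain ⟨q, hq⟩ : ∃ q, fderiv ℝ ψ z₀ (0, 1) = q := ⟨_, rfl⟩
  obtain ⟨a, ha⟩ : ∃ a, fderiv ℝ (fderiv ℝ ψ) z₀ (1, 0) (1, 0) = a := ⟨_, rfl⟩
  obtain ⟨b, hb⟩ : ∃ b, fderiv ℝ (fderiv ℝ ψ) z₀ (1, 0) (0, 1) = b := ⟨_, rfl⟩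
  obtain ⟨d, hd⟩ : ∃ d, fderiv ℝ (fderiv ℝ ψ) z₀ (0, 1) (0, 1) = d := ⟨_, rfl⟩
  have hb' : fderiv ℝ (fderiv ℝ ψ) z₀ (0, 1) (1, 0) = b := by
    rw [← hb]
    exact (hψ0.isSymmSndFDerivAt (by simp)) (0, 1) (1, 0)
  have htr : a + d = -ω (ψ z₀) := by
    rw [← hlap z₀ hz, planeLaplacian_eq_fderiv hψ0, ha, hd]
  have hdψ : HasFDerivAt ψ (fderiv ℝ ψ z₀) z₀ := (hψ0.differentiableAt (by simp)).hasFDerivAt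
  have hd2 := (differentiableAt_fderiv_of_contDiffAt_two hψ0).hasFDerivAt
  -- vanishing of the gradient at the maximum
  have hgrad : p * a + q * b + (ω (ψ z₀) + c) * p = 0 ∧
      p * b + q * d + (ω (ψ z₀) + c) * q + 1 = 0 := by
    have h1 := (ContinuousLinearMap.apply ℝ ℝ ((1 : ℝ), (0 : ℝ))).hasFDerivAt.comp z₀ hd2
    have h2 := (ContinuousLinearMap.apply ℝ ℝ ((0 : ℝ), (1 : ℝ))).hasFDerivAt.comp z₀ hd2
    have h3 := (hK _ hr).comp_hasFDerivAt z₀ hdψ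
    have h4 := ((((h1.pow 2).add (h2.pow 2)).mul_const (2⁻¹ : ℝ)).add h3).add
      (hasFDerivAt_snd (𝕜 := ℝ) (E := ℝ) (F := ℝ) (p := z₀))
    have h5 := IsLocalMax.hasFDerivAt_eq_zero hmax h4
    have e1 := congrArg (fun A : ℝ × ℝ →L[ℝ] ℝ => A (1, 0)) h5
    have e2 := congrArg (fun A : ℝ × ℝ →L[ℝ] ℝ => A (0, 1)) h5
    simp [ha, hb, hb', hd, hp, hq] at e1 e2
    constructor <;> linarith
  -- the differentiated equation in the viscosity sense
  have hnorm : a ^ 2 + 2 * b ^ 2 + d ^ 2 ≤ ω (ψ z₀) * (ω (ψ z₀) + c) := by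
    -- With ε/4 removed from each square coefficient, the quadratic minorant has Laplacian a² + 2b²
    -- + d² - ε.
    refine le_of_forall_pos_le_add fun ε hε => ?_
    have hKat : ContDiffAt ℝ 2 K (ψ z₀) :=
      contDiffAt_two_of_hasDerivAt isOpen_Ioo hr hK (hω.add contDiffOn_const)
    have hKψ : ContDiffAt ℝ 2 (fun z => K (ψ z)) z₀ := hKat.comp z₀ hψ0
    have hlin : ContDiffAt ℝ 2 (fun z : ℝ × ℝ => z.2) z₀ := contDiff_snd.contDiffAt
    have hquad := (contDiff_quadratic ((a ^ 2 + b ^ 2) / 2 - ε / 4) (a * b + b * d)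
      ((b ^ 2 + d ^ 2) / 2 - ε / 4) z₀).contDiffAt (x := z₀)
    have hev := eventually_quadratic_le_gradient_sq hψ0 hp hq ha hb hb' hd
      (by positivity : 0 < ε / 4)
    have hv : ∀ z, fderiv ℝ ψ z (p, q) = p * fderiv ℝ ψ z (1, 0) + q * fderiv ℝ ψ z (0, 1) := by
      intro z
      rw [← smul_eq_mul, ← smul_eq_mul, ← map_smul, ← map_smul, ← map_add]
      congr 1
      ext <;> simp
    have hωd := (hω0.differentiableAt (by simp)).hasDerivAt
    have hfd : HasFDerivAt (fun z => -ω (ψ z)) (-(deriv ω (ψ z₀) • fderiv ℝ ψ z₀)) z₀ :=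
      (hωd.comp_hasFDerivAt z₀ hdψ).neg
    -- The direction is frozen at ∇ψ(z₀). Writing ∇ψ = ∇ψ(z₀) + δ, the linear term plus the
    -- quadratic minorant of |δ|²/2 stays below |∇ψ|²/2 up to a constant, so the maximum persists.
    -- The terms ∓ω'|∇ψ|² from `f` and from ΔK(ψ) cancel.
    have hvisc := fderiv_add_planeLaplacian_nonpos_of_isLocalMax hU (v := (p, q)) hz hψ
      ((hω0.comp z₀ (hψ0.of_le (by norm_num))).neg) ((hKψ.add hlin).add hquad) hlap (by
        filter_upwards [hmax, hev] with z h1 h2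
        simp only [hv, hp, hq] at h1 h2 ⊢
        simp only [sub_self]
        nlinarith)
    rw [planeLaplacian_add (hKψ.add hlin) hquad, planeLaplacian_add hKψ hlin,
      planeLaplacian_quadratic, planeLaplacian_snd,
      planeLaplacian_comp hψ0 (k := fun p => ω p + c)
        (by filter_upwards [isOpen_Ioo.mem_nhds hr] with p hp using hK p hp) (hωd.add_const c),
      hlap z₀ hz, hp, hq] at hvisc
    have hfd' := hfd.fderiv
    simp only [Function.comp_def] at hvisc
    erw [hfd'] at hvisc
    simp only [_root_.neg_apply, _root_.smul_apply, smul_eq_mul, hv, hp,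
      hq] at hvisc
    nlinarith
  rw [hp, hq]
  obtain ⟨hX, hY⟩ := hgrad
  set w := ω (ψ z₀)
  have hX' : p * a + q * b = -(w + c) * p := by linarith
  have hY' : p * b + q * d = -(w + c) * q - 1 := by linarith
  -- For a symmetric 2×2 matrix S, Cayley–Hamilton gives |v|²(|S|² - (tr S)²) = 2|Sv|² - 2 tr S ⟨v,
  -- Sv⟩. The vanishing gradient of the head determines Sv for v = ∇ψ, and the equation determines
  -- tr S.
  have key : (p ^ 2 + q ^ 2) * (a ^ 2 + 2 * b ^ 2 + d ^ 2 - (a + d) ^ 2) =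
      2 * ((p * a + q * b) ^ 2 + (p * b + q * d) ^ 2) -
        2 * (a + d) * (p * (p * a + q * b) + q * (p * b + q * d)) := by ring
  rw [hX', hY', htr] at key
  have hle : (p ^ 2 + q ^ 2) * (a ^ 2 + 2 * b ^ 2 + d ^ 2 - w * (w + c)) ≤ 0 :=
    mul_nonpos_of_nonneg_of_nonpos (by positivity) (by linarith)
  nlinarith

/-! ### Primitives of the vorticity and geometry of the fluid region. -/

/-- A continuous function on `[0,1]` has a primitive there. -/
theorem exists_primitive {ω : ℝ → ℝ} (hω : ContinuousOn ω (Icc 0 1)) :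
    ∃ Ω : ℝ → ℝ, Ω 0 = 0 ∧ ∀ p ∈ Icc (0 : ℝ) 1, HasDerivWithinAt Ω (ω p) (Icc 0 1) p := by
  -- Constant extension beyond the endpoints supplies the global continuity the fundamental theorem
  -- needs.
  set w : ℝ → ℝ := IccExtend (zero_le_one' ℝ) ((Icc 0 1).domRestrict ω) with hw
  have hc : Continuous w := (continuousOn_iff_continuous_domRestrict.1 hω).Icc_extend'
  refine ⟨fun p => ∫ t in (0 : ℝ)..p, w t, by simp, fun p hp => ?_⟩
  have h := (hc.integral_hasStrictDerivAt 0 p).hasDerivAt.hasDerivWithinAt (s := Icc 0 1)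
  rwa [hw, IccExtend_of_mem _ _ hp] at h

theorem image_fluidRegion {η : ℝ → ℝ} (hpos : ∀ x, 0 < η x) (A : Set ℝ) :
    (fun w : ℝ × ℝ => (w.1, w.2 * η w.1)) '' (A ×ˢ Icc 0 1) = {z ∈ fluidRegion η | z.1 ∈ A} := by
  ext ⟨x, y⟩
  simp only [mem_image, mem_prod, Prod.exists, Prod.mk.injEq, fluidRegion, mem_ofPred_eq, mem_Icc]
  constructor
  · rintro ⟨x', s, ⟨hx, hs0, hs1⟩, rfl, rfl⟩
    have := hpos x'
    exact ⟨⟨by positivity, by nlinarith⟩, hx⟩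
  · rintro ⟨⟨h0, h1⟩, hx⟩
    have := hpos x
    exact ⟨x, y / η x, ⟨hx, by positivity, (div_le_one this).2 h1⟩, rfl, by field_simp⟩

/-- The region is the image of a flat strip under (x, s) ↦ (x, sη(x)), whose derivative is onto
since η > 0. -/
theorem uniqueDiffOn_fluidRegion {η : ℝ → ℝ} (hpos : ∀ x, 0 < η x) (hη : ContDiff ℝ 2 η) :
    UniqueDiffOn ℝ (fluidRegion η) := by
  have hd : Differentiable ℝ η := hη.differentiable (by simp)
  have himage := image_fluidRegion hpos univ
  simp only [mem_univ, and_true, ofPred_mem_eq] at himage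
  rw [← himage]
  refine UniqueDiffOn.image (f' := fun w => (ContinuousLinearMap.fst ℝ ℝ ℝ).prod
    (w.2 • (deriv η w.1 • ContinuousLinearMap.fst ℝ ℝ ℝ) +
      η w.1 • ContinuousLinearMap.snd ℝ ℝ ℝ)) ?_ ?_ ?_
  · exact uniqueDiffOn_univ.prod (uniqueDiffOn_Icc zero_lt_one)
  · intro w _
    have h1 : HasFDerivAt (fun w : ℝ × ℝ => η w.1)
        (deriv η w.1 • ContinuousLinearMap.fst ℝ ℝ ℝ) w :=
      (hd w.1).hasDerivAt.comp_hasFDerivAt w hasFDerivAt_fst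
    exact (hasFDerivAt_fst.prodMk (hasFDerivAt_snd.mul h1)).hasFDerivWithinAt
  · intro w _
    refine Function.Surjective.denseRange fun z => ⟨(z.1, (z.2 - w.2 * deriv η w.1 * z.1) / η w.1),
      ?_⟩
    have := (hpos w.1).ne'
    ext
    · simp
    · simp
      field_simp
      ring

/-- The open fluid domain. -/
def openFluidRegion (η : ℝ → ℝ) : Set (ℝ × ℝ) :=
  {z | 0 < z.2 ∧ z.2 < η z.1}

theorem isOpen_openFluidRegion {η : ℝ → ℝ} (hη : Continuous η) : IsOpen (openFluidRegion η) :=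
  (isOpen_lt continuous_const continuous_snd).inter
    (isOpen_lt continuous_snd (hη.comp continuous_fst))

theorem openFluidRegion_subset (η : ℝ → ℝ) : openFluidRegion η ⊆ fluidRegion η :=
  fun _ hz => ⟨hz.1.le, hz.2.le⟩

theorem fluidRegion_subset_closure {η : ℝ → ℝ} (hpos : ∀ x, 0 < η x) (hη : Continuous η) :
    fluidRegion η ⊆ closure (openFluidRegion η) := by
  have himage := image_fluidRegion hpos univ
  simp only [mem_univ, and_true, ofPred_mem_eq] at himage
  have hc : Continuous (fun w : ℝ × ℝ => (w.1, w.2 * η w.1)) := by fun_prop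
  have hcl : (univ : Set ℝ) ×ˢ Icc (0 : ℝ) 1 = closure (univ ×ˢ Ioo 0 1) := by
    rw [closure_prod_eq, closure_univ, closure_Ioo zero_ne_one]
  rw [← himage, hcl]
  refine (image_closure_subset_closure_image hc).trans (closure_mono ?_)
  rintro _ ⟨⟨x, s⟩, ⟨-, hs0, hs1⟩, rfl⟩
  have := hpos x
  exact ⟨mul_pos hs0 this, by simpa using mul_lt_of_lt_one_left this hs1⟩

theorem mem_fluidRegion_top {η : ℝ → ℝ} (hpos : ∀ x, 0 < η x) (x : ℝ) :
    (x, η x) ∈ fluidRegion η :=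
  ⟨(hpos x).le, le_rfl⟩

theorem mem_fluidRegion_bottom {η : ℝ → ℝ} (hpos : ∀ x, 0 < η x) (x : ℝ) :
    (x, 0) ∈ fluidRegion η :=
  ⟨le_rfl, (hpos x).le⟩

/-! ### Derivatives of a solution up to the bed and the surface. -/

namespace IsSolution

variable {γ : ℝ≥0} {ω : ℝ → ℝ} {r : ℝ} {ψ : ℝ × ℝ → ℝ} {η : ℝ → ℝ}

theorem uniqueDiffOn (h : IsSolution γ ω r ψ η) : UniqueDiffOn ℝ (fluidRegion η) :=
  uniqueDiffOn_fluidRegion h.depth_pos h.contDiff_surface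

theorem isOpen (h : IsSolution γ ω r ψ η) : IsOpen (openFluidRegion η) :=
  isOpen_openFluidRegion h.contDiff_surface.continuous

theorem mem_nhds (h : IsSolution γ ω r ψ η) {z : ℝ × ℝ} (hz : z ∈ openFluidRegion η) :
    fluidRegion η ∈ 𝓝 z :=
  mem_of_superset (h.isOpen.mem_nhds hz) (openFluidRegion_subset η)

theorem hasFDerivWithinAt (h : IsSolution γ ω r ψ η) {z : ℝ × ℝ} (hz : z ∈ fluidRegion η) :
    HasFDerivWithinAt ψ (fderivWithin ℝ ψ (fluidRegion η) z) (fluidRegion η) z :=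
  (h.contDiffOn_stream.differentiableOn (by simp) z hz).hasFDerivWithinAt

theorem contDiffOn_fderivWithin (h : IsSolution γ ω r ψ η) :
    ContDiffOn ℝ 1 (fderivWithin ℝ ψ (fluidRegion η)) (fluidRegion η) :=
  h.contDiffOn_stream.fderivWithin h.uniqueDiffOn (by norm_num)

theorem continuousOn_partialX (h : IsSolution γ ω r ψ η) :
    ContinuousOn (partialX η ψ) (fluidRegion η) :=
  h.contDiffOn_fderivWithin.continuousOn.clm_apply continuousOn_const

theorem continuousOn_partialY (h : IsSolution γ ω r ψ η) :
    ContinuousOn (partialY η ψ) (fluidRegion η) :=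
  h.contDiffOn_fderivWithin.continuousOn.clm_apply continuousOn_const

theorem fderivWithin_apply (z v : ℝ × ℝ) :
    fderivWithin ℝ ψ (fluidRegion η) z v = v.1 * partialX η ψ z + v.2 * partialY η ψ z := by
  rw [partialX, partialY, ← smul_eq_mul, ← smul_eq_mul, ← map_smul, ← map_smul, ← map_add]
  congr 1
  ext <;> simp

theorem hasDerivWithinAt_vertical (h : IsSolution γ ω r ψ η) {x y : ℝ}
    (hz : (x, y) ∈ fluidRegion η) :
    HasDerivWithinAt (fun t => ψ (x, t)) (partialY η ψ (x, y)) (Icc 0 (η x)) y :=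
  (h.hasFDerivWithinAt hz).comp_hasDerivWithinAt y (hasDerivAt_mk_right x y).hasDerivWithinAt
    fun _ ht => ht

theorem strictMonoOn_vertical (h : IsSolution γ ω r ψ η) (x : ℝ) :
    StrictMonoOn (fun t => ψ (x, t)) (Icc 0 (η x)) := by
  refine strictMonoOn_of_deriv_pos (convex_Icc _ _)
    (fun t ht => (h.hasDerivWithinAt_vertical ht).continuousWithinAt) fun t ht => ?_
  rw [interior_Icc] at ht
  have hm := Ioo_subset_Icc_self ht
  rw [((h.hasDerivWithinAt_vertical hm).hasDerivAt (Icc_mem_nhds ht.1 ht.2)).deriv]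
  exact h.unidirectional _ hm

theorem stream_mem_Icc (h : IsSolution γ ω r ψ η) {z : ℝ × ℝ} (hz : z ∈ fluidRegion η) :
    ψ z ∈ Icc (0 : ℝ) 1 := by
  have hmono := (h.strictMonoOn_vertical z.1).monotoneOn
  have h0 := hmono ⟨le_rfl, (h.depth_pos z.1).le⟩ hz hz.1
  have h1 := hmono hz ⟨(h.depth_pos z.1).le, le_rfl⟩ hz.2
  simp only [h.kinematic_bottom, h.kinematic_top] at h0 h1
  exact ⟨h0, h1⟩

theorem stream_mem_Ioo (h : IsSolution γ ω r ψ η) {z : ℝ × ℝ} (hz : z ∈ openFluidRegion η) :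
    ψ z ∈ Ioo (0 : ℝ) 1 := by
  have hmono := h.strictMonoOn_vertical z.1
  have hz' := openFluidRegion_subset η hz
  have h0 := hmono ⟨le_rfl, (h.depth_pos z.1).le⟩ hz' hz.1
  have h1 := hmono hz' ⟨(h.depth_pos z.1).le, le_rfl⟩ hz.2
  simp only [h.kinematic_bottom, h.kinematic_top] at h0 h1
  exact ⟨h0, h1⟩

theorem contDiffOn_openFluidRegion (h : IsSolution γ ω r ψ η) :
    ContDiffOn ℝ 2 ψ (openFluidRegion η) :=
  h.contDiffOn_stream.mono (openFluidRegion_subset η)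

theorem planeLaplacian_eq (h : IsSolution γ ω r ψ η) {z : ℝ × ℝ} (hz : z ∈ openFluidRegion η) :
    planeLaplacian ψ z = -ω (ψ z) := by
  have := h.vorticity_eq z.1 z.2 hz.1 hz.2
  linarith

/-- The equation `Δψ + ω(ψ) = 0` holds up to the boundary. -/
theorem laplacian_eq (h : IsSolution γ ω r ψ η) (hω : ContinuousOn ω (Icc 0 1)) {z : ℝ × ℝ}
    (hz : z ∈ fluidRegion η) :
    fderivWithin ℝ (fderivWithin ℝ ψ (fluidRegion η)) (fluidRegion η) z (1, 0) (1, 0) +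
      fderivWithin ℝ (fderivWithin ℝ ψ (fluidRegion η)) (fluidRegion η) z (0, 1) (0, 1) =
      -ω (ψ z) := by
  have hc : ContinuousOn (fderivWithin ℝ (fderivWithin ℝ ψ (fluidRegion η)) (fluidRegion η))
      (fluidRegion η) :=
    (h.contDiffOn_fderivWithin.fderivWithin h.uniqueDiffOn (m := 0) (by norm_num)).continuousOn
  refine EqOn.of_subset_closure (s := openFluidRegion η) (t := fluidRegion η)
    (f := fun z => fderivWithin ℝ (fderivWithin ℝ ψ (fluidRegion η)) (fluidRegion η) z (1, 0) (1, 0)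
      + fderivWithin ℝ (fderivWithin ℝ ψ (fluidRegion η)) (fluidRegion η) z (0, 1) (0, 1))
    (g := fun z => -ω (ψ z)) ?_ ?_ ?_ (openFluidRegion_subset η)
    (fluidRegion_subset_closure h.depth_pos h.contDiff_surface.continuous) hz
  · intro w hw
    have e1 : fderivWithin ℝ ψ (fluidRegion η) =ᶠ[𝓝 w] fderiv ℝ ψ := by
      filter_upwards [h.isOpen.mem_nhds hw] with u hu
      exact fderivWithin_of_mem_nhds (h.mem_nhds hu)
    simp only
    rw [fderivWithin_of_mem_nhds (h.mem_nhds hw), e1.fderiv_eq, ← h.planeLaplacian_eq hw,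
      planeLaplacian_eq_fderiv (h.contDiffOn_openFluidRegion.contDiffAt (h.isOpen.mem_nhds hw))]
  · exact ((hc.clm_apply continuousOn_const).clm_apply continuousOn_const).add
      ((hc.clm_apply continuousOn_const).clm_apply continuousOn_const)
  · exact (hω.comp h.contDiffOn_stream.continuousOn fun w hw => h.stream_mem_Icc hw).neg

/-- Derivatives of the first-order partial derivatives, up to the boundary. -/
theorem exists_hessian (h : IsSolution γ ω r ψ η) (hω : ContinuousOn ω (Icc 0 1)) {z : ℝ × ℝ}
    (hz : z ∈ fluidRegion η) :
    ∃ (A B : ℝ × ℝ →L[ℝ] ℝ) (a b : ℝ), HasFDerivWithinAt (partialX η ψ) A (fluidRegion η) z ∧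
      HasFDerivWithinAt (partialY η ψ) B (fluidRegion η) z ∧
      (∀ v, A v = v.1 * a + v.2 * b) ∧ (∀ v, B v = v.1 * b + v.2 * (-ω (ψ z) - a)) := by
  set S := fderivWithin ℝ (fderivWithin ℝ ψ (fluidRegion η)) (fluidRegion η) z with hS
  have hd : HasFDerivWithinAt (fderivWithin ℝ ψ (fluidRegion η)) S (fluidRegion η) z :=
    (h.contDiffOn_fderivWithin.differentiableOn (by simp) z hz).hasFDerivWithinAt
  have hdir : ∀ e : ℝ × ℝ, HasFDerivWithinAt (fun w => fderivWithin ℝ ψ (fluidRegion η) w e)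
      (S.flip e) (fluidRegion η) z := by
    intro e
    exact (ContinuousLinearMap.apply ℝ ℝ e).hasFDerivAt.comp_hasFDerivWithinAt z hd
  -- Symmetry of the second derivative at a boundary point requires approximation by interior
  -- points.
  have hcl : z ∈ closure (interior (fluidRegion η)) :=
    closure_mono (h.isOpen.subset_interior_iff.2 (openFluidRegion_subset η))
      (fluidRegion_subset_closure h.depth_pos h.contDiff_surface.continuous hz)
  have hsymm : S (0, 1) (1, 0) = S (1, 0) (0, 1) :=
    (h.contDiffOn_stream z hz).isSymmSndFDerivWithinAt (by simp) h.uniqueDiffOn hcl hz _ _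
  have hlap : S (1, 0) (1, 0) + S (0, 1) (0, 1) = -ω (ψ z) := h.laplacian_eq hω hz
  have hexp : ∀ v e : ℝ × ℝ, S v e = v.1 * S (1, 0) e + v.2 * S (0, 1) e := by
    intro v e
    have hv : v = v.1 • ((1 : ℝ), (0 : ℝ)) + v.2 • ((0 : ℝ), (1 : ℝ)) := by ext <;> simp
    conv_lhs => rw [hv, map_add, map_smul, map_smul]
    rfl
  refine ⟨S.flip (1, 0), S.flip (0, 1), S (1, 0) (1, 0), S (1, 0) (0, 1), hdir _, hdir _,
    fun v => ?_, fun v => ?_⟩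
  · rw [ContinuousLinearMap.flip_apply, hexp, hsymm]
  · rw [ContinuousLinearMap.flip_apply, hexp, ← hlap, add_sub_cancel_left]

theorem fderivWithin_add_period (h : IsSolution γ ω r ψ η) {Λ : ℝ} (hη : ∀ x, η (x + Λ) = η x)
    (hψ : ∀ x y, (x, y) ∈ fluidRegion η → ψ (x + Λ, y) = ψ (x, y)) {z : ℝ × ℝ}
    (hz : z ∈ fluidRegion η) :
    fderivWithin ℝ ψ (fluidRegion η) (z + (Λ, 0)) = fderivWithin ℝ ψ (fluidRegion η) z := by
  have hmaps : MapsTo (fun w : ℝ × ℝ => w + (Λ, 0)) (fluidRegion η) (fluidRegion η) := by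
    intro w hw
    simpa [fluidRegion, hη] using hw
  have h1 : HasFDerivWithinAt (fun w : ℝ × ℝ => w + (Λ, 0)) (ContinuousLinearMap.id ℝ (ℝ × ℝ))
      (fluidRegion η) z := (hasFDerivWithinAt_id z _).add_const _
  have h2 := (h.hasFDerivWithinAt (hmaps hz)).comp z h1 hmaps
  rw [ContinuousLinearMap.comp_id] at h2
  have h3 : HasFDerivWithinAt ψ (fderivWithin ℝ ψ (fluidRegion η) (z + (Λ, 0)))
      (fluidRegion η) z := by
    refine h2.congr (fun w hw => ?_) ?_
    · simpa [Prod.add_def] using (hψ w.1 w.2 hw).symm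
    · simpa [Prod.add_def] using (hψ z.1 z.2 hz).symm
  exact (h3.fderivWithin (h.uniqueDiffOn z hz)).symm

theorem hasDerivAt_surface_curve (h : IsSolution γ ω r ψ η) (x : ℝ) :
    HasDerivAt (fun s => (s, η s)) ((1 : ℝ), deriv η x) x :=
  (hasDerivAt_id x).prodMk ((h.contDiff_surface.differentiable (by simp) x).hasDerivAt)

theorem hasDerivAt_along_surface (h : IsSolution γ ω r ψ η) {g : ℝ × ℝ → ℝ}
    {A : ℝ × ℝ →L[ℝ] ℝ} {x : ℝ} (hg : HasFDerivWithinAt g A (fluidRegion η) (x, η x)) :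
    HasDerivAt (fun s => g (s, η s)) (A (1, deriv η x)) x := by
  rw [← hasDerivWithinAt_univ]
  exact hg.comp_hasDerivWithinAt x (h.hasDerivAt_surface_curve x).hasDerivWithinAt
    fun s _ => mem_fluidRegion_top h.depth_pos s

theorem hasDerivWithinAt_along_vertical {g : ℝ × ℝ → ℝ} {A : ℝ × ℝ →L[ℝ] ℝ} {x y : ℝ}
    (hg : HasFDerivWithinAt g A (fluidRegion η) (x, y)) :
    HasDerivWithinAt (fun t => g (x, t)) (A (0, 1)) (Icc 0 (η x)) y :=
  hg.comp_hasDerivWithinAt y (hasDerivAt_mk_right x y).hasDerivWithinAt fun _ ht => ht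

/-- The free surface is a streamline. -/
theorem partialX_surface (h : IsSolution γ ω r ψ η) (x : ℝ) :
    partialX η ψ (x, η x) = -(deriv η x * partialY η ψ (x, η x)) := by
  have h1 := h.hasDerivAt_along_surface (h.hasFDerivWithinAt (mem_fluidRegion_top h.depth_pos x))
  simp only [h.kinematic_top] at h1
  have h2 := h1.unique (hasDerivAt_const x 1)
  rw [fderivWithin_apply] at h2
  linarith

theorem hasDerivAt_along_bottom (h : IsSolution γ ω r ψ η) {g : ℝ × ℝ → ℝ}
    {A : ℝ × ℝ →L[ℝ] ℝ} {x : ℝ} (hg : HasFDerivWithinAt g A (fluidRegion η) (x, 0)) :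
    HasDerivAt (fun s => g (s, 0)) (A (1, 0)) x := by
  rw [← hasDerivWithinAt_univ]
  exact hg.comp_hasDerivWithinAt x (hasDerivAt_mk_left x 0).hasDerivWithinAt
    fun s _ => mem_fluidRegion_bottom h.depth_pos s

theorem partialX_bottom (h : IsSolution γ ω r ψ η) (x : ℝ) : partialX η ψ (x, 0) = 0 := by
  have h1 := h.hasDerivAt_along_bottom (h.hasFDerivWithinAt (mem_fluidRegion_bottom h.depth_pos x))
  simp only [h.kinematic_bottom] at h1
  exact h1.unique (hasDerivAt_const x 0)

end IsSolution

/-! ### The maximum principle for the total head. -/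

theorem nonpos_of_isMaxOn_left {g : ℝ → ℝ} {a b d : ℝ} (hab : a ≤ b)
    (hg : HasDerivWithinAt g d (Icc a b) a) (hmax : ∀ t ∈ Icc a b, g t ≤ g a) :
    (b - a) * d ≤ 0 := by
  have h1 : IsLocalMaxOn g (Icc a b) a :=
    IsMaxOn.localize fun t ht => hmax t ht
  have h2 := h1.hasFDerivWithinAt_nonpos hg.hasFDerivWithinAt (y := b - a)
    (sub_mem_posTangentConeAt_of_segment_subset (segment_eq_Icc hab).subset)
  simpa using h2

theorem nonneg_of_isMaxOn_right {g : ℝ → ℝ} {a b d : ℝ} (hab : a ≤ b)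
    (hg : HasDerivWithinAt g d (Icc a b) b) (hmax : ∀ t ∈ Icc a b, g t ≤ g b) :
    0 ≤ (b - a) * d := by
  have h1 : IsLocalMaxOn g (Icc a b) b :=
    IsMaxOn.localize fun t ht => hmax t ht
  have h2 := h1.hasFDerivWithinAt_nonpos hg.hasFDerivWithinAt (y := a - b)
    (sub_mem_posTangentConeAt_of_segment_subset
      (by rw [segment_symm, segment_eq_Icc hab]))
  simp at h2
  linarith

/-- The total head `|∇ψ|² / 2 + K(ψ) + y`. -/
noncomputable def totalHead (K : ℝ → ℝ) (η : ℝ → ℝ) (ψ : ℝ × ℝ → ℝ) (z : ℝ × ℝ) : ℝ :=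
  (partialX η ψ z ^ 2 + partialY η ψ z ^ 2) / 2 + K (ψ z) + z.2

namespace IsSolution

variable {γ : ℝ≥0} {ω K : ℝ → ℝ} {r c Λ : ℝ} {ψ : ℝ × ℝ → ℝ} {η : ℝ → ℝ}

theorem totalHead_surface (h : IsSolution γ ω r ψ η) (x : ℝ) :
    totalHead K η ψ (x, η x) = r + K 1 := by
  have := h.bernoulli x
  rw [totalHead, h.kinematic_top]
  simp only
  linarith

theorem hasDerivWithinAt_totalHead (h : IsSolution γ ω r ψ η)
    (hK : ∀ p ∈ Icc (0 : ℝ) 1, HasDerivWithinAt K (ω p + c) (Icc 0 1) p) {x y : ℝ}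
    (hz : (x, y) ∈ fluidRegion η) {A B : ℝ × ℝ →L[ℝ] ℝ}
    (hA : HasFDerivWithinAt (partialX η ψ) A (fluidRegion η) (x, y))
    (hB : HasFDerivWithinAt (partialY η ψ) B (fluidRegion η) (x, y)) :
    HasDerivWithinAt (fun t => totalHead K η ψ (x, t))
      (partialX η ψ (x, y) * A (0, 1) + partialY η ψ (x, y) * B (0, 1) +
        (ω (ψ (x, y)) + c) * partialY η ψ (x, y) + 1) (Icc 0 (η x)) y := by
  have h1 := hasDerivWithinAt_along_vertical hA
  have h2 := hasDerivWithinAt_along_vertical hB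
  have h3 := (hK _ (h.stream_mem_Icc hz)).comp y (h.hasDerivWithinAt_vertical hz)
    (fun t (ht : t ∈ Icc 0 (η x)) => h.stream_mem_Icc (z := (x, t)) ht)
  exact (((((h1.pow 2).add (h2.pow 2)).div_const 2).add h3).add
    (hasDerivWithinAt_id y _)).congr_deriv (by simp; ring)

theorem continuousOn_totalHead (h : IsSolution γ ω r ψ η)
    (hK : ∀ p ∈ Icc (0 : ℝ) 1, HasDerivWithinAt K (ω p + c) (Icc 0 1) p) :
    ContinuousOn (totalHead K η ψ) (fluidRegion η) := by
  have hKc : ContinuousOn K (Icc 0 1) := fun p hp => (hK p hp).continuousWithinAt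
  exact ((((h.continuousOn_partialX.pow 2).add (h.continuousOn_partialY.pow 2)).div_const 2).add
    (hKc.comp h.contDiffOn_stream.continuousOn fun z hz => h.stream_mem_Icc hz)).add
    continuous_snd.continuousOn

theorem partialY_add_period (h : IsSolution γ ω r ψ η) (hη : ∀ x, η (x + Λ) = η x)
    (hψ : ∀ x y, (x, y) ∈ fluidRegion η → ψ (x + Λ, y) = ψ (x, y)) {x y : ℝ}
    (hz : (x, y) ∈ fluidRegion η) : partialY η ψ (x + Λ, y) = partialY η ψ (x, y) := by
  have := h.fderivWithin_add_period hη hψ hz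
  simp only [Prod.mk_add_mk, add_zero] at this
  rw [partialY, this, partialY]

theorem totalHead_add_period (h : IsSolution γ ω r ψ η) (hη : ∀ x, η (x + Λ) = η x)
    (hψ : ∀ x y, (x, y) ∈ fluidRegion η → ψ (x + Λ, y) = ψ (x, y)) {x y : ℝ}
    (hz : (x, y) ∈ fluidRegion η) : totalHead K η ψ (x + Λ, y) = totalHead K η ψ (x, y) := by
  have := h.fderivWithin_add_period hη hψ hz
  simp only [Prod.mk_add_mk, add_zero] at this
  rw [totalHead, h.partialY_add_period hη hψ hz, partialX, this, hψ x y hz, totalHead, partialX]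

theorem exists_isMaxOn_totalHead (h : IsSolution γ ω r ψ η)
    (hK : ∀ p ∈ Icc (0 : ℝ) 1, HasDerivWithinAt K (ω p + c) (Icc 0 1) p) (hΛ : 0 < Λ)
    (hη : ∀ x, η (x + Λ) = η x)
    (hψ : ∀ x y, (x, y) ∈ fluidRegion η → ψ (x + Λ, y) = ψ (x, y)) :
    ∃ z₀ ∈ fluidRegion η, ∀ z ∈ fluidRegion η, totalHead K η ψ z ≤ totalHead K η ψ z₀ := by
  have hcont : Continuous (fun w : ℝ × ℝ => (w.1, w.2 * η w.1)) :=
    continuous_fst.prodMk (continuous_snd.mul (h.contDiff_surface.continuous.comp continuous_fst))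
  have hcomp := ((isCompact_Icc (a := (0 : ℝ)) (b := Λ)).prod
    (isCompact_Icc (a := (0 : ℝ)) (b := 1))).image hcont
  rw [image_fluidRegion h.depth_pos] at hcomp
  obtain ⟨z₀, hz₀, hmax⟩ := hcomp.exists_isMaxOn
    ⟨(0, 0), mem_fluidRegion_bottom h.depth_pos 0, ⟨le_rfl, hΛ.le⟩⟩
    ((h.continuousOn_totalHead hK).mono fun z hz => hz.1)
  refine ⟨z₀, hz₀.1, fun z hz => ?_⟩
  -- Moving along the curve of constant relative depth stays in the fluid and gives a Λ-periodic
  -- function of x, so every point can be carried to the compact period cell.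
  have hmem : ∀ x, (x, z.2 / η z.1 * η x) ∈ fluidRegion η := by
    intro x
    have h1 := h.depth_pos x
    have h2 := h.depth_pos z.1
    have h3 : z.2 / η z.1 ≤ 1 := (div_le_one h2).2 hz.2
    have h4 : 0 ≤ z.2 / η z.1 := div_nonneg hz.1 h2.le
    exact ⟨mul_nonneg h4 h1.le, mul_le_of_le_one_left h1.le h3⟩
  have hper : Function.Periodic (fun x => totalHead K η ψ (x, z.2 / η z.1 * η x)) Λ := by
    intro x
    simp only [hη]
    exact h.totalHead_add_period hη hψ (hmem x)
  obtain ⟨x, hx, hxe⟩ := hper.exists_mem_Ico₀ hΛ z.1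
  simp only [div_mul_cancel₀ _ (h.depth_pos z.1).ne', Prod.mk.eta] at hxe
  rw [hxe]
  exact hmax ⟨hmem x, hx.1, hx.2.le⟩

/-- The total head attains its maximum on the free surface. -/
theorem totalHead_le (h : IsSolution γ ω r ψ η) (hω : ContDiffOn ℝ 1 ω (Icc 0 1))
    (hK : ∀ p ∈ Icc (0 : ℝ) 1, HasDerivWithinAt K (ω p + c) (Icc 0 1) p) (hΛ : 0 < Λ)
    (hη : ∀ x, η (x + Λ) = η x)
    (hψ : ∀ x y, (x, y) ∈ fluidRegion η → ψ (x + Λ, y) = ψ (x, y))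
    (hbot : ∀ z ∈ fluidRegion η, 0 < 1 + c * partialY η ψ z)
    (hsrc : ∀ z ∈ fluidRegion η,
      0 < c * (ω (ψ z) + 2 * c) * (partialX η ψ z ^ 2 + partialY η ψ z ^ 2) +
        2 * (1 + (ω (ψ z) + 2 * c) * partialY η ψ z))
    {z : ℝ × ℝ} (hz : z ∈ fluidRegion η) : totalHead K η ψ z ≤ r + K 1 := by
  obtain ⟨⟨x, y⟩, hz₀, hmax⟩ := h.exists_isMaxOn_totalHead hK hΛ hη hψ
  refine (hmax z hz).trans ?_
  rcases eq_or_lt_of_le hz₀.1 with hy | hy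
  -- On the bed ψ_x = 0, hence ψ_xx = 0 and ψ_yy = -ω. The vertical derivative of the head is then 1
  -- + cψ_y > 0, which excludes a maximum.
  · exfalso
    obtain rfl : 0 = y := hy
    obtain ⟨A, B, a, b, hA, hB, hAv, hBv⟩ := h.exists_hessian hω.continuousOn hz₀
    have ha := h.hasDerivAt_along_bottom hA
    simp only [h.partialX_bottom] at ha
    have ha0 := ha.unique (hasDerivAt_const x 0)
    have hd := nonpos_of_isMaxOn_left (h.depth_pos x).le
      (h.hasDerivWithinAt_totalHead hK hz₀ hA hB) (fun t ht => hmax (x, t) ht)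
    rw [hAv] at ha0
    rw [h.partialX_bottom, hAv, hBv] at hd
    simp only at ha0 hd
    have h1 := mul_pos (h.depth_pos x) (hbot _ hz₀)
    have h2 : a = 0 := by linarith
    rw [h2] at hd
    linarith
  · rcases eq_or_lt_of_le hz₀.2 with hy' | hy'
    · simp only at hy'
      rw [hy', h.totalHead_surface]
    · exfalso
      have hU : (x, y) ∈ openFluidRegion η := ⟨hy, hy'⟩
      have heq : ∀ w ∈ openFluidRegion η, fderivWithin ℝ ψ (fluidRegion η) w = fderiv ℝ ψ w :=
        fun w hw => fderivWithin_of_mem_nhds (h.mem_nhds hw)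
      have hIoo : ∀ p ∈ Ioo (0 : ℝ) 1, HasDerivAt K (ω p + c) p := fun p hp =>
        (hK p (Ioo_subset_Icc_self hp)).hasDerivAt (Icc_mem_nhds hp.1 hp.2)
      have hle := source_nonpos_of_isLocalMax h.isOpen hU h.contDiffOn_openFluidRegion
        (hω.mono Ioo_subset_Icc_self) hIoo (fun w hw => h.stream_mem_Ioo hw)
        (fun w hw => h.planeLaplacian_eq hw) (by
          filter_upwards [h.isOpen.mem_nhds hU] with w hw
          have := hmax w (openFluidRegion_subset η hw)
          simpa only [totalHead, partialX, partialY, heq w hw, heq _ hU] using this)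
      have hpos := hsrc _ hz₀
      simp only [partialX, partialY, heq _ hU] at hpos
      linarith

/-- Where the total head is bounded by its value at the surface, the horizontal velocity at the
surface is controlled by the elevation. -/
theorem hasDerivAt_partialY_surface (h : IsSolution γ ω r ψ η) (hω : ContinuousOn ω (Icc 0 1))
    (hK : ∀ p ∈ Icc (0 : ℝ) 1, HasDerivWithinAt K (ω p + c) (Icc 0 1) p)
    (hle : ∀ z ∈ fluidRegion η, totalHead K η ψ z ≤ r + K 1) (x : ℝ) :
    ∃ κ ≤ c, HasDerivAt (fun s => partialY η ψ (s, η s)) (κ * deriv η x) x := by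
  have hz := mem_fluidRegion_top h.depth_pos x
  obtain ⟨A, B, a, b, hA, hB, hAv, hBv⟩ := h.exists_hessian hω hz
  have hd := nonneg_of_isMaxOn_right (h.depth_pos x).le
    (h.hasDerivWithinAt_totalHead hK hz hA hB)
    (fun t ht => (hle (x, t) ht).trans_eq (h.totalHead_surface x).symm)
  have hA' := h.hasDerivAt_along_surface hA
  have hB' := h.hasDerivAt_along_surface hB
  have hη' := (h.contDiff_surface.differentiable (by simp) x).hasDerivAt
  have hbern := (((hA'.pow 2).add (hB'.pow 2)).div_const 2).add hη'
  have hconst := hbern.unique ((hasDerivAt_const x r).congr_of_eventuallyEq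
    (Eventually.of_forall h.bernoulli))
  have hX := h.partialX_surface x
  have hpos := h.unidirectional _ hz
  simp only [hAv, hBv, h.kinematic_top, hX] at hd hconst hB'
  set t := deriv η x
  set q := partialY η ψ (x, η x)
  set w := ω 1
  have hd' := nonneg_of_mul_nonneg_right hd (by simpa using h.depth_pos x)
  -- With ψ_x = -tq, the differentiated Bernoulli law reads q (d/dx ψ_y) = t(q(a + tb) - 1), and
  -- nonnegativity of the vertical derivative of the head reads q(a + tb) - 1 ≤ cq.
  refine ⟨(q * (a + t * b) - 1) / q, ?_, hB'.congr_deriv ?_⟩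
  · rw [div_le_iff₀ hpos]
    nlinarith
  · rw [div_mul_eq_mul_div, eq_div_iff hpos.ne']
    norm_num at hconst ⊢
    linarith

end IsSolution

/-! ### Choices of c and estimates for Stokes waves. -/

theorem exists_abs_le_of_vorticityClass {γ : ℝ≥0} {ω : ℝ → ℝ} (hω : VorticityClass γ ω) :
    ∃ W, 0 ≤ W ∧ ∀ p ∈ Icc (0 : ℝ) 1, |ω p| ≤ W := by
  obtain ⟨W, hW⟩ := isCompact_Icc.exists_bound_of_continuousOn hω.1.continuousOn
  exact ⟨W, (norm_nonneg _).trans (hW 0 (by simp)), hW⟩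

theorem hasDerivWithinAt_add_linear {Ω ω : ℝ → ℝ}
    (hΩ : ∀ p ∈ Icc (0 : ℝ) 1, HasDerivWithinAt Ω (ω p) (Icc 0 1) p) (c : ℝ) :
    ∀ p ∈ Icc (0 : ℝ) 1, HasDerivWithinAt (fun p => Ω p + c * p) (ω p + c) (Icc 0 1) p :=
  fun p hp => ((hΩ p hp).add ((hasDerivWithinAt_id p _).const_mul c)).congr_deriv (by simp)

namespace IsStokesWave

variable {γ : ℝ≥0} {ω Ω : ℝ → ℝ} {r c W : ℝ} {ψ : ℝ × ℝ → ℝ} {η : ℝ → ℝ}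

theorem hasDerivAt_partialY_surface (h : IsStokesWave γ ω r ψ η)
    (hω : ContDiffOn ℝ 1 ω (Icc 0 1))
    (hbot : ∀ z ∈ fluidRegion η, 0 < 1 + c * partialY η ψ z)
    (hsrc : ∀ z ∈ fluidRegion η,
      0 < c * (ω (ψ z) + 2 * c) * (partialX η ψ z ^ 2 + partialY η ψ z ^ 2) +
        2 * (1 + (ω (ψ z) + 2 * c) * partialY η ψ z)) (x : ℝ) :
    ∃ κ ≤ c, HasDerivAt (fun s => partialY η ψ (s, η s)) (κ * deriv η x) x := by
  obtain ⟨hs, Λ, a, hΛ, hη, hψ, -⟩ := h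
  obtain ⟨Ω, -, hΩ⟩ := exists_primitive hω.continuousOn
  have hK := hasDerivWithinAt_add_linear hΩ c
  exact hs.hasDerivAt_partialY_surface hω.continuousOn hK
    (fun z hz => hs.totalHead_le hω hK hΛ hη hψ hbot hsrc hz) x

/-- The choice c = W + 1 makes c and ω + 2c positive, so both positivity conditions are immediate;
then (W + 1)η - ψ_y is nondecreasing wherever η' ≥ 0. -/
theorem partialY_surface_sub_le (h : IsStokesWave γ ω r ψ η) (hω : ContDiffOn ℝ 1 ω (Icc 0 1))
    (hW0 : 0 ≤ W) (hW : ∀ p ∈ Icc (0 : ℝ) 1, |ω p| ≤ W) {x₁ x₂ : ℝ} (hx : x₁ < x₂)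
    (hmono : ∀ x ∈ Ioo x₁ x₂, 0 ≤ deriv η x) :
    partialY η ψ (x₂, η x₂) - partialY η ψ (x₁, η x₁) ≤ (W + 1) * (η x₂ - η x₁) := by
  have hB := h.hasDerivAt_partialY_surface (c := W + 1) hω
    (fun z hz => by
      have := h.1.unidirectional z hz
      positivity)
    (fun z hz => by
      have h1 := h.1.unidirectional z hz
      have h2 := (abs_le.1 (hW _ (h.1.stream_mem_Icc hz))).1
      have h3 : 0 < ω (ψ z) + 2 * (W + 1) := by linarith
      positivity)
  choose κ hκ hd using hB
  have hη : ∀ x, HasDerivAt η (deriv η x) x := fun x =>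
    (h.1.contDiff_surface.differentiable (by simp) x).hasDerivAt
  have hf : ∀ x, HasDerivAt (fun s => (W + 1) * η s - partialY η ψ (s, η s))
      ((W + 1 - κ x) * deriv η x) x := fun x =>
    (((hη x).const_mul (W + 1)).sub (hd x)).congr_deriv (by ring)
  have hm : MonotoneOn (fun s => (W + 1) * η s - partialY η ψ (s, η s)) (Icc x₁ x₂) := by
    refine monotoneOn_of_deriv_nonneg (convex_Icc _ _)
      (fun x _ => (hf x).continuousAt.continuousWithinAt)
      (fun x _ => (hf x).differentiableAt.differentiableWithinAt) fun x hx => ?_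
    rw [interior_Icc] at hx
    rw [(hf x).deriv]
    exact mul_nonneg (by linarith [hκ x]) (hmono x hx)
  have := hm (left_mem_Icc.2 hx.le) (right_mem_Icc.2 hx.le) hx.le
  simp only at this
  linarith

/-- For nonnegative vorticity the velocity is bounded in terms of `r` and `ω`. -/
theorem speed_sq_le (h : IsStokesWave γ ω r ψ η) (hω : ContDiffOn ℝ 1 ω (Icc 0 1))
    (hω0 : ∀ p ∈ Icc (0 : ℝ) 1, 0 ≤ ω p) (hΩ0 : Ω 0 = 0)
    (hΩ : ∀ p ∈ Icc (0 : ℝ) 1, HasDerivWithinAt Ω (ω p) (Icc 0 1) p) {z : ℝ × ℝ}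
    (hz : z ∈ fluidRegion η) :
    partialX η ψ z ^ 2 + partialY η ψ z ^ 2 ≤ 2 * (r + Ω 1) := by
  obtain ⟨hs, Λ, a, hΛ, hη, hψ, -⟩ := h
  -- For c = 0 the source is 2(1 + ωψ_y) > 0. The nonnegative terms Ω(ψ) and y are dropped from the
  -- head below.
  have hle := hs.totalHead_le (c := 0) hω (by simpa using hΩ) hΛ hη hψ (by simp)
    (fun w hw => by
      have h1 := hs.unidirectional w hw
      have h2 := hω0 _ (hs.stream_mem_Icc hw)
      simp only [zero_mul, mul_zero, add_zero, zero_add]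
      positivity) hz
  have hmono : MonotoneOn Ω (Icc 0 1) := by
    refine monotoneOn_of_deriv_nonneg (convex_Icc _ _) (fun p hp => (hΩ p hp).continuousWithinAt)
      (fun p hp => ?_) fun p hp => ?_
    · exact ((hΩ p (interior_subset hp)).mono interior_subset).differentiableWithinAt
    · rw [interior_Icc] at hp
      have hp' := Ioo_subset_Icc_self hp
      rw [((hΩ p hp').hasDerivAt (Icc_mem_nhds hp.1 hp.2)).deriv]
      exact hω0 p hp'
  have hψz := hs.stream_mem_Icc hz
  have hΩz := hmono (left_mem_Icc.2 zero_le_one) hψz hψz.1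
  rw [hΩ0] at hΩz
  have := hz.1
  rw [totalHead] at hle
  linarith

/-- The crest is the highest point of the surface and, if the horizontal velocity decreases
towards the crest at rate at least `ε` relative to the elevation, minimises
`ψ_y + ε η` on the surface. -/
theorem exists_crest (h : IsStokesWave γ ω r ψ η) {ε : ℝ}
    (hd : ∀ x, ∃ κ ≤ -ε, HasDerivAt (fun s => partialY η ψ (s, η s)) (κ * deriv η x) x) :
    ∃ a, (∀ x, η x ≤ η a) ∧ partialY η ψ (a, η a) ^ 2 = 2 * (r - η a) ∧
      ∀ x, partialY η ψ (a, η a) + ε * η a ≤ partialY η ψ (x, η x) + ε * η x := by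
  obtain ⟨hs, Λ, a, hΛ, hper, hψ, hrefl, -, hanti⟩ := h
  choose κ hκ hd using hd
  have hη : ∀ x, HasDerivAt η (deriv η x) x := fun x =>
    (hs.contDiff_surface.differentiable (by simp) x).hasDerivAt
  have hmono : MonotoneOn η (Icc (a - Λ / 2) a) := by
    intro x hx y hy hxy
    rw [← hrefl x, ← hrefl y]
    exact hanti ⟨by linarith [hy.2], by linarith [hy.1]⟩ ⟨by linarith [hx.2], by linarith [hx.1]⟩
      (by linarith)
  -- Since κ + ε ≤ 0, ψ_y + εη varies oppositely to η, so it decreases towards the crest on both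
  -- sides.
  have hf : ∀ x, HasDerivAt (fun s => partialY η ψ (s, η s) + ε * η s)
      ((κ x + ε) * deriv η x) x := fun x =>
    ((hd x).add ((hη x).const_mul ε)).congr_deriv (by ring)
  have hfr : MonotoneOn (fun s => partialY η ψ (s, η s) + ε * η s) (Icc a (a + Λ / 2)) := by
    refine monotoneOn_of_deriv_nonneg (convex_Icc _ _)
      (fun x _ => (hf x).continuousAt.continuousWithinAt)
      (fun x _ => (hf x).differentiableAt.differentiableWithinAt) fun x hx => ?_
    rw [interior_Icc] at hx
    have h1 := hanti.derivWithin_nonpos (x := x)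
    rw [derivWithin_of_mem_nhds (Icc_mem_nhds hx.1 hx.2)] at h1
    rw [(hf x).deriv]
    exact mul_nonneg_of_nonpos_of_nonpos (by linarith [hκ x]) h1
  have hfl : AntitoneOn (fun s => partialY η ψ (s, η s) + ε * η s) (Icc (a - Λ / 2) a) := by
    refine antitoneOn_of_deriv_nonpos (convex_Icc _ _)
      (fun x _ => (hf x).continuousAt.continuousWithinAt)
      (fun x _ => (hf x).differentiableAt.differentiableWithinAt) fun x hx => ?_
    rw [interior_Icc] at hx
    have h1 := hmono.derivWithin_nonneg (x := x)
    rw [derivWithin_of_mem_nhds (Icc_mem_nhds hx.1 hx.2)] at h1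
    rw [(hf x).deriv]
    exact mul_nonpos_of_nonpos_of_nonneg (by linarith [hκ x]) h1
  have hΛ2 : a ≤ a + Λ / 2 := by linarith
  have hΛ2' : a - Λ / 2 ≤ a := by linarith
  have hcrest : ∀ x, η x ≤ η a := by
    intro x
    obtain ⟨y, hy, hxy⟩ := Function.Periodic.exists_mem_Ico (f := η) (c := Λ) hper hΛ x (a - Λ / 2)
    rw [hxy]
    rcases le_total y a with hya | hya
    · exact hmono ⟨hy.1, hya⟩ (right_mem_Icc.2 hΛ2') hya
    · exact hanti (left_mem_Icc.2 hΛ2) ⟨hya, by linarith [hy.2]⟩ hya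
  refine ⟨a, hcrest, ?_, fun x => ?_⟩
  · have h0 : deriv η a = 0 := IsLocalMax.deriv_eq_zero (Eventually.of_forall hcrest)
    have h1 := hs.bernoulli a
    rw [hs.partialX_surface, h0] at h1
    linarith
  · have hfper : Function.Periodic (fun s => partialY η ψ (s, η s) + ε * η s) Λ := by
      intro s
      simp only [hper]
      rw [hs.partialY_add_period hper hψ (mem_fluidRegion_top hs.depth_pos s)]
    obtain ⟨y, hy, hxy⟩ := hfper.exists_mem_Ico hΛ x (a - Λ / 2)
    refine le_trans ?_ hxy.ge
    rcases le_total y a with hya | hya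
    · exact hfl ⟨hy.1, hya⟩ (right_mem_Icc.2 hΛ2') hya
    · exact hfr (left_mem_Icc.2 hΛ2) ⟨hya, by linarith [hy.2]⟩ hya

/-- This is the case c = -ε. The negative terms of the source are at most εω|∇ψ|² ≤ εWV and 4εψ_y ≤
4ε(V + 1), which the smallness of ε keeps below the constant 2. -/
theorem deriv_partialY_surface_le_neg (h : IsStokesWave γ ω r ψ η)
    (hω : ContDiffOn ℝ 1 ω (Icc 0 1)) (hω0 : ∀ p ∈ Icc (0 : ℝ) 1, 0 ≤ ω p)
    (hW : ∀ p ∈ Icc (0 : ℝ) 1, |ω p| ≤ W) {V ε : ℝ} (hε : 0 < ε)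
    (hV : ∀ z ∈ fluidRegion η, partialX η ψ z ^ 2 + partialY η ψ z ^ 2 ≤ V)
    (hεV : ε * (W * V + 4 * (V + 1)) < 1) (x : ℝ) :
    ∃ κ ≤ -ε, HasDerivAt (fun s => partialY η ψ (s, η s)) (κ * deriv η x) x := by
  have hbd : ∀ z ∈ fluidRegion η, 0 ≤ ω (ψ z) ∧ ω (ψ z) ≤ W ∧ 0 < partialY η ψ z ∧
      partialY η ψ z ≤ V + 1 := by
    intro z hz
    have hz' := h.1.stream_mem_Icc hz
    refine ⟨hω0 _ hz', (abs_le.1 (hW _ hz')).2, h.1.unidirectional z hz, ?_⟩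
    nlinarith [hV z hz, sq_nonneg (partialX η ψ z), sq_nonneg (partialY η ψ z - 1)]
  refine h.hasDerivAt_partialY_surface hω (fun z hz => ?_) (fun z hz => ?_) x
  · obtain ⟨h1, h2, h3, h4⟩ := hbd z hz
    have h5 : 0 ≤ V := (by positivity : (0 : ℝ) ≤ _).trans (hV z hz)
    have h6 : 0 ≤ W * V := mul_nonneg (h1.trans h2) h5
    have h7 := mul_le_mul_of_nonneg_left h4 hε.le
    nlinarith [mul_nonneg hε.le h6, mul_nonneg hε.le h5]
  · obtain ⟨h1, h2, h3, h4⟩ := hbd z hz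
    set S := partialX η ψ z ^ 2 + partialY η ψ z ^ 2 with hS
    have hS0 : 0 ≤ S := by positivity
    have h5 := mul_le_mul h2 (hV z hz) hS0 (h1.trans h2)
    have h6 := mul_le_mul_of_nonneg_left h5 hε.le
    have h7 := mul_le_mul_of_nonneg_left h4 hε.le
    have h8 := mul_nonneg h1 h3.le
    have h9 := mul_nonneg (mul_nonneg hε.le hε.le) hS0
    nlinarith

/-- Bounds for the horizontal velocity and the slope of the surface, given that the horizontal
velocity decreases towards the crest at rate at least `ε` relative to the elevation. -/
theorem surface_bounds (h : IsStokesWave γ ω r ψ η) {ε : ℝ} (hε : 0 < ε) (hε1 : ε ≤ 1)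
    (hd : ∀ x, ∃ κ ≤ -ε, HasDerivAt (fun s => partialY η ψ (s, η s)) (κ * deriv η x) x) (x : ℝ) :
    η x ≤ (⨆ t, η t) ∧ 0 < r - η x ∧
      (r - (⨆ t, η t) ≤ 1 / 2 → ε * (r - η x) ≤ partialY η ψ (x, η x)) ∧
      (1 / 2 < r - (⨆ t, η t) → 1 ≤ partialY η ψ (x, η x)) ∧
      deriv η x ^ 2 ≤ (2 / ε ^ 2 + 2 * r ^ 2) * (r - η x)⁻¹ := by
  obtain ⟨a, hcrest, ha, hmin⟩ := h.exists_crest hd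
  have hsup : (⨆ t, η t) = η a :=
    le_antisymm (ciSup_le hcrest) (le_ciSup ⟨η a, forall_mem_range.2 hcrest⟩ a)
  have hBa := h.1.unidirectional _ (mem_fluidRegion_top h.1.depth_pos a)
  have hBx := h.1.unidirectional _ (mem_fluidRegion_top h.1.depth_pos x)
  have hbern := h.1.bernoulli x
  rw [h.1.partialX_surface] at hbern
  have hx := hmin x
  have hxa := hcrest x
  have hηx := h.1.depth_pos x
  rw [hsup]
  set A := partialY η ψ (a, η a)
  set B := partialY η ψ (x, η x)
  set t := deriv η x
  have hpos : 0 < r - η x := by nlinarith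
  have hmul := mul_le_mul_of_nonneg_left hxa hε.le
  -- Here A² = 2(r - η(a)) ≤ 1, so A ≥ A² ≥ r - η(a) ≥ ε(r - η(a)); minimality of ψ_y + εη at the
  -- crest carries this to x.
  have hlow : r - η a ≤ 1 / 2 → ε * (r - η x) ≤ B := by
    intro hle
    have hA1 : A ≤ 1 := by nlinarith
    have hA2 : r - η a ≤ A := by nlinarith
    have hA3 : ε * (r - η a) ≤ A := by nlinarith
    linarith
  have hhigh : 1 / 2 < r - η a → 1 ≤ B := by
    intro hlt
    have hA1 : 1 ≤ A := by nlinarith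
    linarith
  refine ⟨hxa, hpos, hlow, hhigh, ?_⟩
  rw [← div_eq_mul_inv, le_div_iff₀ hpos]
  -- The Bernoulli law on the surface is (1 + t²)B² = 2(r - η).
  have htB : t ^ 2 * B ^ 2 ≤ 2 * (r - η x) := by nlinarith [sq_nonneg B]
  rcases le_or_gt (r - η a) (1 / 2) with hc | hc
  · have h1 := hlow hc
    have h2 : (ε * (r - η x)) ^ 2 ≤ B ^ 2 := pow_le_pow_left₀ (by positivity) h1 2
    have h3 : t ^ 2 * (ε * (r - η x)) ^ 2 ≤ 2 * (r - η x) :=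
      (mul_le_mul_of_nonneg_left h2 (sq_nonneg t)).trans htB
    have h4 : (t ^ 2 * (r - η x)) * ε ^ 2 ≤ 2 := by
      refine le_of_mul_le_mul_right ?_ hpos
      linarith
    have h5 : t ^ 2 * (r - η x) ≤ 2 / ε ^ 2 := (le_div_iff₀ (by positivity)).2 h4
    linarith [sq_nonneg r]
  · have h1 := hhigh hc
    have h2 : 1 ≤ B ^ 2 := one_le_pow₀ h1
    have h3 : t ^ 2 ≤ 2 * (r - η x) := by nlinarith [sq_nonneg t]
    have h4 : t ^ 2 * (r - η x) ≤ 2 * (r - η x) * (r - η x) :=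
      mul_le_mul_of_nonneg_right h3 hpos.le
    -- Positive depth gives r - η < r.
    have h5 : (r - η x) * (r - η x) ≤ r * r :=
      mul_self_le_mul_self hpos.le (by linarith)
    have h6 : 0 ≤ 2 / ε ^ 2 := by positivity
    nlinarith

end IsStokesWave

end WaterWave

/-! ### Constants depending only on r and ω. -/

theorem proposition3p3
    (ω : ℝ → ℝ)
    (hω : ∃ γ : ℝ≥0, 0 < γ ∧ γ < 1 ∧ WaterWave.VorticityClass γ ω)
    (r : ℝ) (hr : WaterWave.criticalBernoulli ω < r) :
    (∃ C₁ : ℝ, 0 < C₁ ∧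
      ∀ (γ : ℝ≥0) (ψ : ℝ × ℝ → ℝ) (η : ℝ → ℝ), 0 < γ → γ < 1 →
        WaterWave.IsStokesWave γ ω r ψ η →
        ∀ x₁ x₂ : ℝ, x₁ < x₂ → (∀ x ∈ Set.Ioo x₁ x₂, 0 ≤ deriv η x) →
          WaterWave.partialY η ψ (x₂, η x₂) - WaterWave.partialY η ψ (x₁, η x₁)
            ≤ C₁ * (η x₂ - η x₁)) ∧
    ((∀ p ∈ Set.Icc (0 : ℝ) 1, 0 ≤ ω p) →
      (∃ C₂ C₃ : ℝ, 0 < C₂ ∧ 0 < C₃ ∧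
        ∀ (γ : ℝ≥0) (ψ : ℝ × ℝ → ℝ) (η : ℝ → ℝ), 0 < γ → γ < 1 →
          WaterWave.IsStokesWave γ ω r ψ η →
          ∀ x : ℝ,
            (r - (⨆ t, η t) ≤ 1 / 2 →
              C₂ * (r - η x) ≤ WaterWave.partialY η ψ (x, η x)) ∧
            (1 / 2 < r - (⨆ t, η t) → 1 ≤ WaterWave.partialY η ψ (x, η x)) ∧
            deriv η x ^ 2 ≤ C₃ * (r - η x)⁻¹) ∧
      (∀ δ : ℝ, 0 < δ → ∃ M : ℝ,
        ∀ (γ : ℝ≥0) (ψ : ℝ × ℝ → ℝ) (η : ℝ → ℝ), 0 < γ → γ < 1 →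
          WaterWave.IsStokesWave γ ω r ψ η →
          (⨆ t, η t) ≤ r - δ → ∀ x : ℝ, |deriv η x| ≤ M)) := by
  obtain ⟨γ₀, -, -, hclass⟩ := hω
  have hω1 := hclass.1
  obtain ⟨W, hW0, hW⟩ := WaterWave.exists_abs_le_of_vorticityClass hclass
  refine ⟨⟨W + 1, by positivity, fun γ ψ η _ _ h x₁ x₂ hx hmono =>
    h.partialY_surface_sub_le hω1 hW0 hW hx hmono⟩, fun hω0 => ?_⟩
  obtain ⟨Ω, hΩ0, hΩ⟩ := WaterWave.exists_primitive hω1.continuousOn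
  obtain ⟨V, hV0, hV⟩ : ∃ V, 0 ≤ V ∧ 2 * (r + Ω 1) ≤ V :=
    ⟨2 * |r + Ω 1|, by positivity, by linarith [le_abs_self (r + Ω 1)]⟩
  obtain ⟨ε, hε, hε1, hεV⟩ : ∃ ε : ℝ, 0 < ε ∧ ε ≤ 1 ∧ ε * (W * V + 4 * (V + 1)) < 1 := by
    have hWV := mul_nonneg hW0 hV0
    have hden : 0 < 1 + (W * V + 4 * (V + 1)) := by positivity
    refine ⟨1 / (1 + (W * V + 4 * (V + 1))), by positivity, ?_, ?_⟩
    · rw [div_le_one hden]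
      linarith
    · rw [div_mul_eq_mul_div, div_lt_one hden]
      linarith
  have key : ∀ (γ : ℝ≥0) (ψ : ℝ × ℝ → ℝ) (η : ℝ → ℝ), WaterWave.IsStokesWave γ ω r ψ η →
      ∀ x : ℝ, η x ≤ (⨆ t, η t) ∧ 0 < r - η x ∧
        (r - (⨆ t, η t) ≤ 1 / 2 → ε * (r - η x) ≤ WaterWave.partialY η ψ (x, η x)) ∧
        (1 / 2 < r - (⨆ t, η t) → 1 ≤ WaterWave.partialY η ψ (x, η x)) ∧
        deriv η x ^ 2 ≤ (2 / ε ^ 2 + 2 * r ^ 2) * (r - η x)⁻¹ := fun γ ψ η h x =>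
    h.surface_bounds hε hε1 (h.deriv_partialY_surface_le_neg hω1 hω0 hW hε
      (fun z hz => (h.speed_sq_le hω1 hω0 hΩ0 hΩ hz).trans hV) hεV) x
  refine ⟨⟨ε, 2 / ε ^ 2 + 2 * r ^ 2, hε, by positivity, fun γ ψ η _ _ h x => ?_⟩,
    fun δ hδ => ⟨Real.sqrt ((2 / ε ^ 2 + 2 * r ^ 2) * δ⁻¹), fun γ ψ η _ _ h hsup x => ?_⟩⟩
  · exact (key γ ψ η h x).2.2
  -- Since η ≤ sup η ≤ r - δ, the factor (r - η)⁻¹ is at most δ⁻¹.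
  · obtain ⟨h1, h2, -, -, h3⟩ := key γ ψ η h x
    refine Real.abs_le_sqrt (h3.trans ?_)
    gcongr
    linarith
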